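/- **Setting.** Let $H$ be a complex Hilbert space, $\mathcal A\subseteq B(H)$ a C*-algebra containing $I$, $A$ a norm-dense $*$-subalgebra of $\mathcal A$ with $I\in A$, and $D$ a self-adjoint, possibly unbounded, operator on $H$. For an operator $S$ and a bounded operator $a$, the commutator $[S,a]=Sa-aS$ has the domain $\{x\in\mathrm{dom}\,S: ax\in\mathrm{dom}\,S\}$, and if it is bounded and densely defined then $\|[S,a]\|$ denotes the norm of its closure. Assume that $(A,H,D)$ is a spectral triple: $[D,a]$ is bounded and densely defined for each $a\in A$, and $(I+D^2)^{-1}$ is compact. Let $P\in B(H)$ be an orthogonal projection and let $C(PH)$ be the algebra of compact operators on $PH$. For $a\in B(H)$ put $T(a)=Pa|_{PH}\in B(PH)$. Assume that $((A,H,D),P)$ is of Toeplitz type, i.e. 1. $P$ commutes with $D$, and $Pa-aP$ is compact for all $a\in\mathcal A$; 2. with $\kappa:B(PH)\to B(PH)/C(PH)$ the quotient map, $\varphi(a)=\kappa(T(a))$ is injective on $\mathcal A$; 3. for each $a\in A$ the commutators $[PD,a]$ and $[(I-P)D,a]$ are bounded and densely defined, and $\mathrm{dom}([D,a])\cap PH$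 and $\mathrm{dom}([D,a])\cap(I-P)H$ are dense in $PH$ and in $(I-P)H$ respectively; 4. $D_p:=D|_{PH}$ has trivial kernel. Assume also that $a\mapsto\overline{[D,a]}$ (the bounded closure of the commutator) is additive on the self-adjoint elements of $A$; this is automatic, for instance, if every $a\in A$ maps $\mathrm{dom}\,D$ into itself. **The order-unit spaces and seminorms.** Let $A_c$ be the set of $k\in C(PH)$ such that $D_pk$ is everywhere defined and bounded and $kD_p$ is bounded. Put $A_{\mathcal A}=\{a\in A: a=a^*\}$, $A_{\mathcal C}=\{k+\lambda I: k=k^*\in A_c,\ \lambda\in\mathbb R\}$ and $A_{\mathcal T}=T(A_{\mathcal A})+A_{\mathcal C}\subseteq B(PH)$. These are ordered by the usual order of self-adjoint operators, with order unit $I$. Let $L_{\mathcal A}(a)=\|[D,a]\|$ for $a\in A_{\mathcal A}$. Let $K=PH\oplus H$. For $t\in A_{\mathcal T}$ let $\rho(t)$ be the element of $\mathcal A$ with $\varphi(\rho(t))=\kappa(t)$, and let $\pi(t)=t\oplus\rho(t)$ on $K$. For $\alpha,\beta>0$ let $D_{\alpha,\beta}$ be the operator on $K$ with domain $(\mathrm{dom}\,D\cap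 PH)\oplus\mathrm{dom}\,D$ which, with respect to $K=PH\oplus PH\oplus(I-P)H$ and with $D_q=D|_{(I-P)H}$, has the matrix $$D_{\alpha,\beta}=\begin{pmatrix}0&\beta D_p&0\\ \beta D_p&\tfrac1\alpha D_p&0\\ 0&0&\tfrac1\alpha D_q\end{pmatrix}.$$ Let $L_{\alpha,\beta}(t)=\|[D_{\alpha,\beta},\pi(t)]\|$ for $t\in A_{\mathcal T}$. **Lip-norms.** Let $(V,e)$ be an order-unit space (a real partially ordered vector space with an archimedean order unit $e$), with the norm $\|v\|=\inf\{r:-re\le v\le re\}$. Its state space $S(V)$ is the set of linear functionals $\mu$ with $\mu(e)=1=\|\mu\|$. A Lip-norm on $V$ is a seminorm $L$ such that $L(v)=0$ if and only if $v\in\mathbb Re$, and such that the metric $\rho_L(\mu,\nu)=\sup\{|\mu(v)-\nu(v)|: L(v)\le1\}$ induces the weak*-topology on $S(V)$. An order-unit space with a Lip-norm is a compact quantum metric space. **Proposition.** If $L_{\mathcal A}$ is a Lip-norm on $A_{\mathcal A}$, then for all $\alpha,\beta>0$ with $\alpha\beta\le1$ the commutators $[D_{\alpha,\beta},\pi(t)]$,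 $t\in A_{\mathcal T}$, are bounded and densely defined, and $L_{\alpha,\beta}$ is a Lip-norm on $A_{\mathcal T}$. Thus $(A_{\mathcal T},L_{\alpha,\beta})$ is a compact quantum metric space. -/

import Mathlib

open scoped ENNReal

noncomputable section

/-! ### Order-unit spaces, state spaces, Lip-norms -/

section OrderUnit

variable {V : Type*} [AddCommGroup V] [PartialOrder V] [Module ℝ V]

/-- `(V, e)` is an order-unit space: a real partially ordered vector space with an archimedean
order unit `e`. -/
structure IsOrderUnitSpace (e : V) : Prop where
  add_le_add_right : ∀ a b c : V, a ≤ b → a + c ≤ b + c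
  smul_le_smul : ∀ (r : ℝ) (a b : V), 0 ≤ r → a ≤ b → r • a ≤ r • b
  order_unit : ∀ a : V, ∃ r : ℝ, a ≤ r • e
  archimedean : ∀ a : V, (∀ r : ℝ, 0 < r → a ≤ r • e) → a ≤ 0

/-- The order-unit norm `‖a‖ = inf {r : -r e ≤ a ≤ r e}`. -/
def orderUnitNorm (e a : V) : ℝ := sInf {r : ℝ | -(r • e) ≤ a ∧ a ≤ r • e}

/-- The state space: linear functionals `μ` with `μ e = 1 = ‖μ‖`. Only `‖μ‖ ≤ 1` has to be
demanded, since `‖e‖ ≤ 1` and `μ e = 1` give `1 ≤ ‖μ‖`. -/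
def OrderUnitState (e : V) : Type _ :=
  {μ : V →ₗ[ℝ] ℝ // μ e = 1 ∧ ∀ a, |μ a| ≤ orderUnitNorm e a}

/-- The weak*-topology on the state space. -/
@[reducible]
def weakStarTopology (e : V) : TopologicalSpace (OrderUnitState e) :=
  TopologicalSpace.induced (fun (μ : OrderUnitState e) (a : V) => μ.1 a) Pi.topologicalSpace

/-- `ρ_L(μ, ν) = sup {|μ a - ν a| : L a ≤ 1}`, which may be infinite. -/
def lipDist (e : V) (L : V → ℝ) (μ ν : OrderUnitState e) : ℝ≥0∞ :=
  ⨆ (a : V) (_ : L a ≤ 1), ENNReal.ofReal |μ.1 a - ν.1 a|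

/-- The state space as an (extended) metric space for `ρ_L`; distances and uniformity are the
ones generated by `lipDist`. -/
@[reducible]
def lipPseudoEMetric (e : V) (L : V → ℝ) : PseudoEMetricSpace (OrderUnitState e) where
  edist := lipDist e L
  edist_self μ := by simp [lipDist]
  edist_comm μ ν := by simp only [lipDist, abs_sub_comm]
  edist_triangle μ ν ξ := by
    refine iSup₂_le fun a ha => ?_
    calc ENNReal.ofReal |μ.1 a - ξ.1 a|
        ≤ ENNReal.ofReal (|μ.1 a - ν.1 a| + |ν.1 a - ξ.1 a|) :=
          ENNReal.ofReal_le_ofReal (abs_sub_le _ _ _)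
      _ = ENNReal.ofReal |μ.1 a - ν.1 a| + ENNReal.ofReal |ν.1 a - ξ.1 a| :=
          ENNReal.ofReal_add (abs_nonneg _) (abs_nonneg _)
      _ ≤ lipDist e L μ ν + lipDist e L ν ξ :=
          add_le_add (le_iSup₂_of_le a ha le_rfl) (le_iSup₂_of_le a ha le_rfl)

/-- The topology on the state space given by the metric `ρ_L`. -/
@[reducible]
def lipTopology (e : V) (L : V → ℝ) : TopologicalSpace (OrderUnitState e) :=
  (lipPseudoEMetric e L).toUniformSpace.toTopologicalSpace

/-- A Lip-norm: a seminorm `L` with null space `ℝ e` such that `ρ_L` induces the weak*-topology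
on the state space. -/
structure IsLipNorm (e : V) (L : V → ℝ) : Prop where
  add_le : ∀ a b, L (a + b) ≤ L a + L b
  smul : ∀ (r : ℝ) (a : V), L (r • a) = |r| * L a
  eq_zero_iff : ∀ a, L a = 0 ↔ ∃ r : ℝ, a = r • e
  topology_eq : lipTopology e L = weakStarTopology e

/-- `(V, e)` with `L` is a compact quantum metric space. -/
structure IsCompactQuantumMetricSpace (e : V) (L : V → ℝ) : Prop where
  isOrderUnitSpace : IsOrderUnitSpace e
  isLipNorm : IsLipNorm e L

end OrderUnit

/-! ### Commutators with unbounded operators -/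

section Unbounded

variable {E : Type*} [NormedAddCommGroup E] [InnerProductSpace ℂ E]

/-- The commutator `[D, a] = D a - a D` with its natural domain
`{x ∈ dom D : a x ∈ dom D}`. -/
def pcomm (D : E →ₗ.[ℂ] E) (a : E →L[ℂ] E) : E →ₗ.[ℂ] E where
  domain := D.domain ⊓ D.domain.comap (a : E →ₗ[ℂ] E)
  toFun :=
    { toFun := fun x => D ⟨a x, x.2.2⟩ - a (D ⟨x, x.2.1⟩)
      map_add' := fun x y => by
        have h1 : (⟨a ((x + y : _) : E), (x + y).2.2⟩ : D.domain)
            = ⟨a x, x.2.2⟩ + ⟨a y, y.2.2⟩ := by ext; simp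
        have h2 : (⟨((x + y : _) : E), (x + y).2.1⟩ : D.domain)
            = ⟨x, x.2.1⟩ + ⟨y, y.2.1⟩ := by ext; simp
        rw [h1, h2, D.map_add, D.map_add, map_add]; abel
      map_smul' := fun c x => by
        have h1 : (⟨a ((c • x : _) : E), (c • x).2.2⟩ : D.domain) = c • ⟨a x, x.2.2⟩ := by
          ext; simp
        have h2 : (⟨((c • x : _) : E), (c • x).2.1⟩ : D.domain) = c • ⟨x, x.2.1⟩ := by
          ext; simp
        rw [h1, h2, D.map_smul, D.map_smul, map_smul, RingHom.id_apply, smul_sub] }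

/-- A partially defined operator is bounded and densely defined. -/
def IsBddDense (S : E →ₗ.[ℂ] E) : Prop :=
  Dense (S.domain : Set E) ∧ ∃ C : ℝ, ∀ x : S.domain, ‖S x‖ ≤ C * ‖(x : E)‖

/-- The operator norm of a bounded partially defined operator; for a densely defined one it is
the norm of its closure. -/
def pnorm (S : E →ₗ.[ℂ] E) : ℝ :=
  sInf {C : ℝ | 0 ≤ C ∧ ∀ x : S.domain, ‖S x‖ ≤ C * ‖(x : E)‖}

/-- The everywhere defined bounded operator `X` extends `S`; if `S` is densely defined then `X`
is the closure of `S`. -/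
def ExtendsTo (S : E →ₗ.[ℂ] E) (X : E →L[ℂ] E) : Prop :=
  ∀ x : S.domain, X (x : E) = S x

end Unbounded

section Toeplitz

variable {H : Type*} [NormedAddCommGroup H] [InnerProductSpace ℂ H] [CompleteSpace H]

/-! ### Spectral triples -/

/-- `(A, H, D)` is a spectral triple associated to the unital C*-algebra `𝒜` acting on `H`. The
operator `R` in `compact_resolvent` is `(I + D²)⁻¹`. -/
structure IsSpectralTriple (𝒜 A : StarSubalgebra ℂ (H →L[ℂ] H)) (D : H →ₗ.[ℂ] H) : Prop where
  closure_eq : A.topologicalClosure = 𝒜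
  selfAdjoint : IsSelfAdjoint D
  comm : ∀ a ∈ A, IsBddDense (pcomm D a)
  compact_resolvent : ∃ R : H →L[ℂ] H, IsCompactOperator R ∧
    ∀ x : H, ∃ (h₁ : R x ∈ D.domain) (h₂ : D ⟨R x, h₁⟩ ∈ D.domain),
      R x + D ⟨D ⟨R x, h₁⟩, h₂⟩ = x

/-- The map sending a self-adjoint `a` in `A` to the closure of `[D, a]` is additive. (This is
what makes `a ↦ ‖[D, a]‖` and its relatives seminorms; it is automatic when each `a` in `A` maps
`dom D` into itself.) -/
def CommutatorClosureAdditive (A : StarSubalgebra ℂ (H →L[ℂ] H)) (D : H →ₗ.[ℂ] H) : Prop :=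
  ∀ a ∈ A, ∀ b ∈ A, IsSelfAdjoint a → IsSelfAdjoint b → ∀ X Y Z : H →L[ℂ] H,
    ExtendsTo (pcomm D a) X → ExtendsTo (pcomm D b) Y → ExtendsTo (pcomm D (a + b)) Z → Z = X + Y

/-! ### Projections and quadruples of Toeplitz type

An orthogonal projection `P` on `H` is given by its range `Hp = PH`, a complete subspace; then
`P = Hp.starProjection`, and `(I - P) H = Hpᗮ`. -/

variable (Hp : Submodule ℂ H) [CompleteSpace Hp]

/-- The compression `T(a) = P a | PH`. -/
def compression : (H →L[ℂ] H) →ₗ[ℂ] (Hp →L[ℂ] Hp) where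
  toFun a := Hp.orthogonalProjectionOnto ∘L a ∘L Hp.subtypeL
  map_add' a b := by ext; simp
  map_smul' c a := by ext; simp

/-- The Calkin algebra `B(PH) / C(PH)` (as a vector space). -/
abbrev Calkin : Type _ := (Hp →L[ℂ] Hp) ⧸ compactOperator (RingHom.id ℂ) Hp Hp

/-- The quotient map `κ : B(PH) → B(PH) / C(PH)`. -/
def calkinMk : (Hp →L[ℂ] Hp) →ₗ[ℂ] Calkin Hp := Submodule.mkQ _

/-- `φ(a) = κ(P a | PH)`. -/
def toeplitzPhi : (H →L[ℂ] H) →ₗ[ℂ] Calkin Hp := calkinMk Hp ∘ₗ compression Hp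

/-- `P` is of Toeplitz type for the spectral triple: it commutes with `D`, it commutes with `𝒜`
modulo the compact operators, and `φ` is faithful on `𝒜`. -/
structure IsToeplitzProjection (𝒜 : StarSubalgebra ℂ (H →L[ℂ] H)) (D : H →ₗ.[ℂ] H) : Prop where
  commutes_dirac : ∀ x : D.domain, ∃ h : Hp.starProjection (x : H) ∈ D.domain,
    D ⟨Hp.starProjection (x : H), h⟩ = Hp.starProjection (D x)
  commutes_mod_compact : ∀ a ∈ 𝒜,
    IsCompactOperator (Hp.starProjection ∘L a - a ∘L Hp.starProjection)
  faithful : Set.InjOn (toeplitzPhi Hp) (𝒜 : Set (H →L[ℂ] H))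

/-- The operator `D_p = D | PH` on `PH`, with domain `dom D ∩ PH`. (If `P` commutes with `D` then
`D` maps `dom D ∩ PH` into `PH`, so that the projection in the formula is the identity there.) -/
def diracP (D : H →ₗ.[ℂ] H) : Hp →ₗ.[ℂ] Hp where
  domain := D.domain.comap Hp.subtype
  toFun :=
    { toFun := fun u => Hp.orthogonalProjectionOnto (D ⟨(u : Hp), u.2⟩)
      map_add' := fun u v => by
        have h : (⟨(((u + v : _) : Hp) : H), (u + v).2⟩ : D.domain)
            = ⟨(u : Hp), u.2⟩ + ⟨(v : Hp), v.2⟩ := by ext; simp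
        rw [h, D.map_add, map_add]
      map_smul' := fun c u => by
        have h : (⟨(((c • u : _) : Hp) : H), (c • u).2⟩ : D.domain)
            = c • ⟨(u : Hp), u.2⟩ := by ext; simp
        rw [h, D.map_smul, map_smul, RingHom.id_apply] }

/-- The quadruple `((A, H, D), P)` is of Toeplitz type. Here `P D` and `(I - P) D` have domain
`dom D`, so their commutators with `a` have the same natural domain as `[D, a]`; the
intersections of this domain with `PH` and with `(I - P) H` are required to be dense there. -/
structure IsToeplitzQuadruple (𝒜 A : StarSubalgebra ℂ (H →L[ℂ] H)) (D : H →ₗ.[ℂ] H) : Prop where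
  spectralTriple : IsSpectralTriple 𝒜 A D
  projection : IsToeplitzProjection Hp 𝒜 D
  comm_p : ∀ a ∈ A, IsBddDense (pcomm ((Hp.starProjection : H →ₗ[ℂ] H).compPMap D) a)
  comm_q : ∀ a ∈ A, IsBddDense
    (pcomm (((1 - Hp.starProjection : H →L[ℂ] H) : H →ₗ[ℂ] H).compPMap D) a)
  dense_p : ∀ a ∈ A, Dense {u : Hp | (u : H) ∈ (pcomm D a).domain}
  dense_q : ∀ a ∈ A, Dense {u : Hpᗮ | (u : H) ∈ (pcomm D a).domain}
  ker_trivial : ∀ u : (diracP Hp D).domain, diracP Hp D u = 0 → (u : Hp) = 0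

/-! ### The order-unit spaces and the seminorms -/

/-- `A_c`: the compact operators `k` on `PH` such that `D_p k` and `k D_p` are bounded; for
`D_p k` this means that `k` maps `PH` into `dom D_p` and that `D_p k` is a bounded operator. -/
def compactSmooth (D : H →ₗ.[ℂ] H) : Submodule ℂ (Hp →L[ℂ] Hp) where
  carrier := {k | IsCompactOperator k ∧
    (∃ C : ℝ, ∀ x : Hp, ∃ h : k x ∈ (diracP Hp D).domain,
      ‖diracP Hp D ⟨k x, h⟩‖ ≤ C * ‖x‖) ∧
    (∃ C : ℝ, ∀ u : (diracP Hp D).domain, ‖k (diracP Hp D u)‖ ≤ C * ‖(u : Hp)‖)}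
  zero_mem' := by
    refine ⟨isCompactOperator_zero, ⟨0, fun x => ⟨by simp, ?_⟩⟩, ⟨0, fun u => by simp⟩⟩
    have h : (⟨(0 : Hp →L[ℂ] Hp) x, by simp⟩ : (diracP Hp D).domain) = 0 := by ext; simp
    rw [h, (diracP Hp D).map_zero]; simp
  add_mem' := by
    rintro k l ⟨hk, ⟨C, hC⟩, ⟨C', hC'⟩⟩ ⟨hl, ⟨B, hB⟩, ⟨B', hB'⟩⟩
    refine ⟨hk.add hl, ⟨C + B, fun x => ?_⟩, ⟨C' + B', fun u => ?_⟩⟩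
    · obtain ⟨h1, h1'⟩ := hC x
      obtain ⟨h2, h2'⟩ := hB x
      refine ⟨(diracP Hp D).domain.add_mem h1 h2, ?_⟩
      have h : (⟨(k + l) x, (diracP Hp D).domain.add_mem h1 h2⟩ : (diracP Hp D).domain)
          = ⟨k x, h1⟩ + ⟨l x, h2⟩ := rfl
      rw [h, (diracP Hp D).map_add, add_mul]
      exact (norm_add_le _ _).trans (add_le_add h1' h2')
    · rw [add_mul]
      exact (norm_add_le _ _).trans (add_le_add (hC' u) (hB' u))
  smul_mem' := by
    rintro c k ⟨hk, ⟨C, hC⟩, ⟨C', hC'⟩⟩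
    refine ⟨hk.smul c, ⟨‖c‖ * C, fun x => ?_⟩, ⟨‖c‖ * C', fun u => ?_⟩⟩
    · obtain ⟨h1, h1'⟩ := hC x
      refine ⟨(diracP Hp D).domain.smul_mem c h1, ?_⟩
      have h : (⟨(c • k) x, (diracP Hp D).domain.smul_mem c h1⟩ : (diracP Hp D).domain)
          = c • ⟨k x, h1⟩ := rfl
      rw [h, (diracP Hp D).map_smul, norm_smul, mul_assoc]
      exact mul_le_mul_of_nonneg_left h1' (norm_nonneg c)
    · rw [smul_apply, norm_smul, mul_assoc]
      exact mul_le_mul_of_nonneg_left (hC' u) (norm_nonneg c)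

/-- The self-adjoint part of `A_c`. -/
def compactSmoothSA (D : H →ₗ.[ℂ] H) : Submodule ℝ (Hp →L[ℂ] Hp) :=
  (compactSmooth Hp D).restrictScalars ℝ ⊓ selfAdjoint.submodule ℝ (Hp →L[ℂ] Hp)

/-- `A_𝒞`: the operators `k + λ I` with `k = k*` in `A_c` and `λ` real. -/
def spaceC (D : H →ₗ.[ℂ] H) : Submodule ℝ (Hp →L[ℂ] Hp) :=
  compactSmoothSA Hp D ⊔ Submodule.span ℝ {1}

/-- `A_𝒜`: the self-adjoint elements of `A`. -/
def spaceA (A : StarSubalgebra ℂ (H →L[ℂ] H)) : Submodule ℝ (H →L[ℂ] H) :=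
  A.toSubalgebra.toSubmodule.restrictScalars ℝ ⊓ selfAdjoint.submodule ℝ (H →L[ℂ] H)

/-- `A_𝒯 = T(A_𝒜) + A_𝒞`. -/
def spaceT (A : StarSubalgebra ℂ (H →L[ℂ] H)) (D : H →ₗ.[ℂ] H) : Submodule ℝ (Hp →L[ℂ] Hp) :=
  (spaceA A).map ((compression Hp).restrictScalars ℝ) ⊔ spaceC Hp D

/-- The order unit of `A_𝒜`. -/
def unitA (A : StarSubalgebra ℂ (H →L[ℂ] H)) : spaceA A :=
  ⟨1, A.one_mem, IsSelfAdjoint.one _⟩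

/-- The order unit of `A_𝒯`. -/
def unitT (A : StarSubalgebra ℂ (H →L[ℂ] H)) (D : H →ₗ.[ℂ] H) : spaceT Hp A D :=
  ⟨1, Submodule.mem_sup_right (Submodule.mem_sup_right (Submodule.mem_span_singleton_self 1))⟩

/-- `L_𝒜(a) = ‖[D, a]‖`. -/
def lipA (A : StarSubalgebra ℂ (H →L[ℂ] H)) (D : H →ₗ.[ℂ] H) (a : spaceA A) : ℝ :=
  pnorm (pcomm D (a : H →L[ℂ] H))

/-- The Hilbert space `K = PH ⊕ H`. -/
abbrev toeplitzK : Type _ := WithLp 2 (Hp × H)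

/-- `ρ(t) = φ⁻¹(κ(t))`, the element `a` of `𝒜` with `φ(a) = κ(t)`. -/
def toeplitzRho (𝒜 : StarSubalgebra ℂ (H →L[ℂ] H)) (t : Hp →L[ℂ] Hp) : H →L[ℂ] H :=
  Function.invFunOn (toeplitzPhi Hp) (𝒜 : Set (H →L[ℂ] H)) (calkinMk Hp t)

/-- `π(t) = t ⊕ ρ(t)` on `K = PH ⊕ H`. -/
def toeplitzPi (𝒜 : StarSubalgebra ℂ (H →L[ℂ] H)) (t : Hp →L[ℂ] Hp) :
    toeplitzK Hp →L[ℂ] toeplitzK Hp :=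
  ((WithLp.prodContinuousLinearEquiv 2 ℂ Hp H).symm : (Hp × H) →L[ℂ] toeplitzK Hp) ∘L
    (t.prodMap (toeplitzRho Hp 𝒜 t)) ∘L
    ((WithLp.prodContinuousLinearEquiv 2 ℂ Hp H) : toeplitzK Hp →L[ℂ] (Hp × H))

/-- The operator `D_{α,β}` on `K = PH ⊕ H`, with domain `(dom D ∩ PH) ⊕ dom D`, given by
`(u, v) ↦ (β P D v, β D_p u + α⁻¹ D v)`. Since `P` commutes with `D`, with respect to
`K = PH ⊕ PH ⊕ (I - P) H` this is the matrix with rows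
`(0, β D_p, 0)`, `(β D_p, α⁻¹ D_p, 0)` and `(0, 0, α⁻¹ D_q)`. -/
def diracAB (D : H →ₗ.[ℂ] H) (α β : ℝ) : toeplitzK Hp →ₗ.[ℂ] toeplitzK Hp where
  domain := ((diracP Hp D).domain.prod D.domain).comap
    (WithLp.linearEquiv 2 ℂ (Hp × H)).toLinearMap
  toFun :=
    { toFun := fun x => WithLp.toLp 2
        ((β : ℂ) • Hp.orthogonalProjectionOnto (D ⟨(x : toeplitzK Hp).snd, x.2.2⟩),
          (β : ℂ) • ((diracP Hp D ⟨(x : toeplitzK Hp).fst, x.2.1⟩ : Hp) : H) +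
            ((α⁻¹ : ℝ) : ℂ) • D ⟨(x : toeplitzK Hp).snd, x.2.2⟩)
      map_add' := fun x y => by
        have h1 : (⟨((x + y : _) : toeplitzK Hp).fst, (x + y).2.1⟩ : (diracP Hp D).domain)
            = ⟨(x : toeplitzK Hp).fst, x.2.1⟩ + ⟨(y : toeplitzK Hp).fst, y.2.1⟩ := by
          ext; simp
        have h2 : (⟨((x + y : _) : toeplitzK Hp).snd, (x + y).2.2⟩ : D.domain)
            = ⟨(x : toeplitzK Hp).snd, x.2.2⟩ + ⟨(y : toeplitzK Hp).snd, y.2.2⟩ := by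
          ext; simp
        rw [h1, h2, D.map_add, (diracP Hp D).map_add, ← WithLp.toLp_add, Prod.mk_add_mk,
          map_add, Submodule.coe_add, smul_add, smul_add, smul_add, add_add_add_comm]
      map_smul' := fun c x => by
        have h1 : (⟨((c • x : _) : toeplitzK Hp).fst, (c • x).2.1⟩ : (diracP Hp D).domain)
            = c • ⟨(x : toeplitzK Hp).fst, x.2.1⟩ := by ext; simp
        have h2 : (⟨((c • x : _) : toeplitzK Hp).snd, (c • x).2.2⟩ : D.domain)
            = c • ⟨(x : toeplitzK Hp).snd, x.2.2⟩ := by ext; simp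
        rw [h1, h2, D.map_smul, (diracP Hp D).map_smul, RingHom.id_apply, ← WithLp.toLp_smul,
          Prod.smul_mk, map_smul, Submodule.coe_smul, smul_add, smul_comm c, smul_comm c,
          smul_comm c] }

/-- `L_{α,β}(t) = ‖[D_{α,β}, π(t)]‖`. -/
def lipAB (𝒜 A : StarSubalgebra ℂ (H →L[ℂ] H)) (D : H →ₗ.[ℂ] H) (α β : ℝ)
    (t : spaceT Hp A D) : ℝ :=
  pnorm (pcomm (diracAB Hp D α β) (toeplitzPi Hp 𝒜 (t : Hp →L[ℂ] Hp)))

end Toeplitz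

end

/-!
An element of `A_𝒯` is `t = T(a) + k` with `a` self-adjoint in `A` and `k` self-adjoint in `A_c`,
and `ρ(t) = a`. Hence `π(t) = t ⊕ a`, and the commutator with `D_{α,β}` has, with respect to
`PH ⊕ H`, the entries `0`, `β (P D a - t P D)`, `β (D_p t - a D_p)` and `α⁻¹ [D, a]`. The operator
`D_{α,β}` is symmetric and `π(t)` self-adjoint, so the two corners are, up to sign, adjoint to each
other, and boundedness need only be checked for `P D a - t P D = P [P D, a] - k D_p P`
(`IsToeplitzQuadruple.isBddDense`).

The domains of the commutators vary with `t`, so that subadditivity of the seminorm requires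
additivity of the closures. The lower right corner is additive by hypothesis, and the others are
then additive because of weak formulas for them in which the only unbounded operators have domains
that do not depend on `t` (`IsToeplitzQuadruple.extension_add`).

From the entries one reads off `‖[D, a]‖ ≤ α L(t)` and, restricting the upper right corner to `PH`,
`‖D_p k‖ = ‖k D_p‖ ≤ (α + β⁻¹) L(t)`, where `L = L_{α,β}`
(`IsToeplitzQuadruple.pnorm_pcomm_le`, `IsToeplitzQuadruple.norm_diracP_apply_le`). If `L(t) = 0`
then `a` is a scalar, and `k = 0` because `D_p` is injective.

A seminorm with null space `ℝ e` induces the weak*-topology on the states if its unit ball is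
totally bounded modulo `ℝ e` in the order-unit norm (`lipTopology_eq_weakStarTopology`), and
conversely the unit ball of a Lip-norm is totally bounded modulo `ℝ e`, since its members are
`1`-Lipschitz functions on the compact space of states (`IsLipNorm.exists_finite_net`). So the set
of `a` with `‖[D, a]‖ ≤ α` is totally bounded modulo scalars. The set of `k` with
`‖D_p k‖ ≤ α + β⁻¹` is totally bounded because `D` has compact resolvent and `D_p` is injective:
such `k` map the unit ball into a graph ball of `D`, which is totally bounded
(`totallyBounded_graphBall`), and self-adjointness turns this into total boundedness of the set of
operators (`exists_finite_net_of_symmetric`).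
-/

open scoped InnerProductSpace

/-! ### Lip-norms and total boundedness -/

section OrderUnit

variable {V : Type*} [AddCommGroup V] [PartialOrder V] [Module ℝ V]

theorem orderUnitNorm_le {e a : V} {r : ℝ} (hr : 0 ≤ r) (h₁ : -(r • e) ≤ a) (h₂ : a ≤ r • e) :
    orderUnitNorm e a ≤ r := by
  unfold orderUnitNorm
  by_cases h : BddBelow {r : ℝ | -(r • e) ≤ a ∧ a ≤ r • e}
  · exact csInf_le h ⟨h₁, h₂⟩
  · -- an infimum of a set of reals that is not bounded below has the value `0`
    rw [Real.sInf_of_not_bddBelow h]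
    exact hr

/-- The unit ball of `L` is totally bounded modulo the scalar multiples of `e`, for the order-unit
norm. -/
def TotallyBoundedModUnit (e : V) (L : V → ℝ) : Prop :=
  ∀ ε : ℝ, 0 < ε → ∃ F : Set V, F.Finite ∧ ∀ a, L a ≤ 1 → ∃ f ∈ F, ∃ r : ℝ,
    -(ε • e) ≤ a - f - r • e ∧ a - f - r • e ≤ ε • e

theorem lipDist_le_iff {e : V} {L : V → ℝ} {μ ν : OrderUnitState e} {c : ℝ} (hc : 0 ≤ c) :
    lipDist e L μ ν ≤ ENNReal.ofReal c ↔ ∀ a, L a ≤ 1 → |μ.1 a - ν.1 a| ≤ c := by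
  simp only [lipDist, iSup_le_iff]
  exact forall₂_congr fun a _ => ENNReal.ofReal_le_ofReal_iff hc

/-- Total boundedness of the unit ball modulo scalars gives the weak*-topology: up to `ε`, the
distance of two states is then controlled by their values on finitely many elements. -/
theorem lipTopology_eq_weakStarTopology {e : V} {L : V → ℝ} (hnonneg : ∀ a, 0 ≤ L a)
    (hsmul : ∀ (r : ℝ) (a : V), L (r • a) = |r| * L a)
    (hzero : ∀ a, L a = 0 → ∃ r : ℝ, a = r • e) (hL : TotallyBoundedModUnit e L) :
    lipTopology e L = weakStarTopology e := by
  apply le_antisymm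
  · rw [← continuous_iff_le_induced]
    let _ := lipPseudoEMetric e L
    refine continuous_pi fun a => ?_
    have : LipschitzWith (L a).toNNReal (fun μ : OrderUnitState e => μ.1 a) := by
      intro μ ν
      rw [edist_dist, Real.dist_eq]
      change _ ≤ _ * lipDist e L μ ν
      rcases (hnonneg a).eq_or_lt with h | h
      · obtain ⟨r, rfl⟩ := hzero a h.symm
        simp [μ.2.1, ν.2.1]
      · have h1 : ENNReal.ofReal |μ.1 ((L a)⁻¹ • a) - ν.1 ((L a)⁻¹ • a)| ≤ lipDist e L μ ν :=
          le_iSup₂_of_le ((L a)⁻¹ • a) (by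
            rw [hsmul, abs_of_pos (inv_pos.2 h), inv_mul_cancel₀ h.ne']) le_rfl
        have h2 : |μ.1 a - ν.1 a|
            = L a * |μ.1 ((L a)⁻¹ • a) - ν.1 ((L a)⁻¹ • a)| := by
          rw [map_smul, map_smul, ← smul_sub, smul_eq_mul, abs_mul, abs_of_pos (inv_pos.2 h),
            mul_inv_cancel_left₀ h.ne']
        rw [h2, ENNReal.ofReal_mul h.le]
        exact mul_le_mul_right h1 _
    exact this.continuous
  · refine le_of_nhds_le_nhds fun μ => ?_
    let _ := lipPseudoEMetric e L
    refine (Metric.nhds_basis_eball.ge_iff (α := OrderUnitState e)).2 fun ε hε => ?_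
    obtain ⟨δ, hδ, hδε⟩ : ∃ δ : ℝ, 0 < δ ∧ ENNReal.ofReal (3 * δ) < ε := by
      obtain ⟨c, hc, hcε⟩ := ENNReal.lt_iff_exists_nnreal_btwn.1 hε
      refine ⟨c / 3, by have : 0 < c := by exact_mod_cast hc
                        positivity, ?_⟩
      rwa [mul_div_cancel₀ _ (by norm_num : (3 : ℝ) ≠ 0), ENNReal.ofReal_coe_nnreal]
    obtain ⟨F, hF, hcov⟩ := hL δ hδ
    have hnhds : ∀ᶠ ν in @nhds _ (weakStarTopology e) μ, ∀ f ∈ F, |ν.1 f - μ.1 f| < δ := by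
      rw [Filter.eventually_all_finite hF]
      intro f _
      let _ := weakStarTopology e
      have hcont : Continuous (fun ν : OrderUnitState e => ν.1 f) :=
        (continuous_apply f).comp continuous_induced_dom
      exact (hcont.tendsto μ).eventually (Metric.ball_mem_nhds _ hδ)
    filter_upwards [hnhds] with ν hν
    change lipDist e L ν μ < ε
    refine lt_of_le_of_lt ((lipDist_le_iff (by positivity)).2 fun a ha => ?_) hδε
    obtain ⟨f, hf, r, h1, h2⟩ := hcov a ha
    have key : ∀ ξ : OrderUnitState e, |ξ.1 a - ξ.1 f - r| ≤ δ := by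
      intro ξ
      have := (ξ.2.2 _).trans (orderUnitNorm_le hδ.le h1 h2)
      simpa [ξ.2.1] using this
    have h3 := abs_le.1 (key ν)
    have h4 := abs_le.1 (key μ)
    have h5 := abs_lt.1 (hν f hf)
    rw [abs_le]
    constructor <;> linarith [h3.1, h3.2, h4.1, h4.2, h5.1, h5.2]

/-- Banach–Alaoglu for the state space: it is closed in the compact product of the intervals
`[-‖a‖, ‖a‖]`. -/
theorem compactSpace_weakStarTopology (e : V) :
    @CompactSpace (OrderUnitState e) (weakStarTopology e) := by
  let _ := weakStarTopology e
  set ι : OrderUnitState e → V → ℝ := fun μ a => μ.1 a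
  have hι : Topology.IsInducing ι := ⟨rfl⟩
  refine ⟨hι.isCompact_iff.2 ?_⟩
  have hrange : ι '' Set.univ = {g : V → ℝ | (∀ a b, g (a + b) = g a + g b) ∧
      (∀ (r : ℝ) a, g (r • a) = r * g a) ∧ g e = 1 ∧ ∀ a, |g a| ≤ orderUnitNorm e a} := by
    ext g
    constructor
    · rintro ⟨μ, -, rfl⟩
      exact ⟨map_add μ.1, fun r a => by simp [ι], μ.2.1, μ.2.2⟩
    · rintro ⟨h1, h2, h3, h4⟩
      exact ⟨⟨⟨⟨g, h1⟩, h2⟩, h3, h4⟩, trivial, rfl⟩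
  rw [hrange]
  refine (isCompact_univ_pi fun a => isCompact_Icc
    (a := -orderUnitNorm e a) (b := orderUnitNorm e a)).of_isClosed_subset ?_
    fun g hg a _ => abs_le.1 (hg.2.2.2 a)
  simp only [Set.ofPred_and, Set.ofPred_forall]
  refine (isClosed_iInter fun a => isClosed_iInter fun b => ?_).inter
    ((isClosed_iInter fun r => isClosed_iInter fun a => ?_).inter
      (IsClosed.inter ?_ (isClosed_iInter fun a => ?_)))
  · exact isClosed_eq (by fun_prop) (by fun_prop)
  · exact isClosed_eq (by fun_prop) (by fun_prop)
  · exact isClosed_eq (by fun_prop) (by fun_prop)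
  · exact isClosed_le (by fun_prop) (by fun_prop)

/-- A family in a totally bounded set has a finite net that consists of members of the family. -/
theorem exists_finite_net_of_totallyBounded {α X : Type*} [PseudoMetricSpace X] (s : Set α)
    (g : α → X) (hg : TotallyBounded (g '' s)) {ε : ℝ} (hε : 0 < ε) :
    ∃ F ⊆ s, F.Finite ∧ ∀ a ∈ s, ∃ f ∈ F, dist (g a) (g f) < ε := by
  obtain ⟨G, hGs, hG, hcov⟩ := hg.exists_subset (Metric.dist_mem_uniformity hε)
  choose pre hpre using fun y : G => hGs y.2
  have := hG.to_subtype
  refine ⟨Set.range pre, ?_, Set.finite_range pre, fun a ha => ?_⟩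
  · rintro _ ⟨y, rfl⟩
    exact (hpre y).1
  · obtain ⟨y, hy, hay⟩ := Set.mem_iUnion₂.1 (hcov ⟨a, ha, rfl⟩)
    refine ⟨pre ⟨y, hy⟩, ⟨⟨y, hy⟩, rfl⟩, ?_⟩
    rw [(hpre ⟨y, hy⟩).2]
    exact hay

theorem exists_finite_net_pi {α ι X : Type*} [Finite ι] [PseudoMetricSpace X] (s : Set α)
    (g : α → ι → X) {K : Set X} (hK : IsCompact K) (hg : ∀ a ∈ s, ∀ i, g a i ∈ K)
    {ε : ℝ} (hε : 0 < ε) :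
    ∃ F ⊆ s, F.Finite ∧ ∀ a ∈ s, ∃ f ∈ F, ∀ i, dist (g a i) (g f i) < ε := by
  have := Fintype.ofFinite ι
  obtain ⟨F, hFs, hF, hnet⟩ := exists_finite_net_of_totallyBounded s g
    ((isCompact_univ_pi fun _ : ι => hK).totallyBounded.subset (by
      rintro _ ⟨a, ha, rfl⟩ i -
      exact hg a ha i)) hε
  exact ⟨F, hFs, hF, fun a ha => (hnet a ha).imp fun f hf => ⟨hf.1, (dist_pi_lt_iff hε).1 hf.2⟩⟩

/-- The distance of two states for a Lip-norm is finite: the states `(1 - s) μ + s ν` converge to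
`μ` for the weak*-topology as `s → 0`, and their distance from `μ` is `s` times that of `ν`. -/
theorem IsLipNorm.exists_bound {e : V} {L : V → ℝ} (hL : IsLipNorm e L) (μ ν : OrderUnitState e) :
    ∃ M : ℝ, ∀ a, L a ≤ 1 → |μ.1 a - ν.1 a| ≤ M := by
  have hconv : ∀ s : ℝ, s ∈ Set.Icc (0 : ℝ) 1 → ∃ ξ : OrderUnitState e,
      ∀ a, ξ.1 a = μ.1 a + s * (ν.1 a - μ.1 a) := by
    intro s hs
    refine ⟨⟨μ.1 + s • (ν.1 - μ.1), by simp [μ.2.1, ν.2.1], fun a => ?_⟩, fun a => by simp⟩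
    have h1 := abs_le.1 (μ.2.2 a)
    have h2 := abs_le.1 (ν.2.2 a)
    have : (μ.1 + s • (ν.1 - μ.1)) a = (1 - s) * μ.1 a + s * ν.1 a := by
      simp; ring
    rw [this, abs_le]
    constructor <;> nlinarith [hs.1, hs.2, h1.1, h1.2, h2.1, h2.2]
  have : Nonempty (OrderUnitState e) := ⟨μ⟩
  choose! ξ hξ using hconv
  have hlim : Filter.Tendsto ξ (nhdsWithin 0 (Set.Ioc 0 1)) (@nhds _ (weakStarTopology e) μ) := by
    let _ := weakStarTopology e
    rw [nhds_induced, Filter.tendsto_comap_iff, tendsto_pi_nhds]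
    intro a
    have h1 : Filter.Tendsto (fun s : ℝ => μ.1 a + s * (ν.1 a - μ.1 a))
        (nhdsWithin 0 (Set.Ioc 0 1)) (nhds (μ.1 a)) := by
      have : Continuous (fun s : ℝ => μ.1 a + s * (ν.1 a - μ.1 a)) := by fun_prop
      simpa using (this.tendsto 0).mono_left nhdsWithin_le_nhds
    refine h1.congr' ?_
    filter_upwards [self_mem_nhdsWithin] with s hs
    exact (hξ s ⟨hs.1.le, hs.2⟩ a).symm
  rw [← hL.topology_eq] at hlim
  have hev : ∀ᶠ s in nhdsWithin (0 : ℝ) (Set.Ioc 0 1), lipDist e L (ξ s) μ < 1 := by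
    let _ := lipPseudoEMetric e L
    exact hlim.eventually (Metric.eball_mem_nhds μ one_pos)
  have hne : (nhdsWithin (0 : ℝ) (Set.Ioc 0 1)).NeBot := by
    rw [nhdsWithin_Ioc_eq_nhdsGT one_pos]; infer_instance
  obtain ⟨s, hs, hs'⟩ := (hev.and self_mem_nhdsWithin).exists
  refine ⟨1 / s, fun a ha => ?_⟩
  have h1 := (lipDist_le_iff (c := 1) (by norm_num)).1 (by simpa using hs.le) a ha
  rw [hξ s ⟨hs'.1.le, hs'.2⟩, add_sub_cancel_left, abs_mul, abs_of_pos hs'.1] at h1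
  rw [le_div_iff₀ hs'.1, abs_sub_comm, mul_comm]
  exact h1

/-- For a Lip-norm the unit ball modulo scalars is totally bounded, in the norm that the states
define: its members are `1`-Lipschitz on the compact space of states. -/
theorem IsLipNorm.exists_finite_net {e : V} {L : V → ℝ} (hL : IsLipNorm e L) {ε : ℝ} (hε : 0 < ε) :
    ∃ F : Set V, F.Finite ∧ ∀ a, L a ≤ 1 → ∃ f ∈ F, ∃ r : ℝ, ∀ μ : OrderUnitState e,
      |μ.1 (a - f - r • e)| ≤ ε := by
  rcases isEmpty_or_nonempty (OrderUnitState e) with hemp | ⟨⟨μ₀⟩⟩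
  · exact ⟨{0}, Set.finite_singleton 0, fun a _ => ⟨0, rfl, 0, fun μ => hemp.elim μ⟩⟩
  obtain ⟨t, ht⟩ : ∃ t : Finset (OrderUnitState e), ∀ μ : OrderUnitState e, ∃ ν ∈ t,
      ∀ a, L a ≤ 1 → |μ.1 a - ν.1 a| ≤ ε / 3 := by
    have hc := compactSpace_weakStarTopology e
    rw [← hL.topology_eq] at hc
    let _ := lipPseudoEMetric e L
    obtain ⟨t, ht⟩ := hc.elim_nhds_subcover (fun μ => Metric.eball μ (ENNReal.ofReal (ε / 3)))
      fun μ => Metric.eball_mem_nhds μ (by simpa using hε)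
    refine ⟨t, fun μ => ?_⟩
    have : μ ∈ (⊤ : Set (OrderUnitState e)) := trivial
    rw [← ht] at this
    obtain ⟨ν, hν, hμ⟩ := Set.mem_iUnion₂.1 this
    exact ⟨ν, hν, (lipDist_le_iff (by positivity)).1 (le_of_lt hμ)⟩
  choose M hM using fun ν : OrderUnitState e => hL.exists_bound ν μ₀
  obtain ⟨B, hB⟩ : ∃ B, ∀ ν : t, M ν ≤ B :=
    (Set.finite_range fun ν : t => M ν).bddAbove.imp fun B hB ν => hB ⟨ν, rfl⟩
  obtain ⟨F, hFs, hF, hnet⟩ := exists_finite_net_pi {a | L a ≤ 1}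
    (fun a (ν : t) => (ν : OrderUnitState e).1 a - μ₀.1 a) (isCompact_Icc (a := -B) (b := B))
    (fun a ha ν => abs_le.1 ((hM ν a ha).trans (hB ν))) (by positivity : 0 < ε / 3)
  refine ⟨F, hF, fun a ha => ?_⟩
  obtain ⟨f, hf, hfa⟩ := hnet a ha
  refine ⟨f, hf, μ₀.1 a - μ₀.1 f, fun μ => ?_⟩
  obtain ⟨ν, hν, hμν⟩ := ht μ
  have h1 := abs_le.1 (hμν a ha)
  have h2 := abs_le.1 (hμν f (hFs hf))
  have h3 := abs_lt.1 (hfa ⟨ν, hν⟩)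
  dsimp only at h3
  simp only [map_sub, map_smul, μ.2.1, smul_eq_mul, mul_one]
  rw [abs_le]
  constructor <;> linarith [h1.1, h1.2, h2.1, h2.2, h3.1, h3.2]

end OrderUnit

/-! ### Bounded commutators -/

section Unbounded

variable {E : Type*} [NormedAddCommGroup E] [InnerProductSpace ℂ E]

theorem norm_le_of_forall_inner_le {s : Set E} (hs : Dense s) {x : E} {C : ℝ} (hC : 0 ≤ C)
    (h : ∀ w ∈ s, ‖⟪x, w⟫_ℂ‖ ≤ C * ‖w‖) : ‖x‖ ≤ C := by
  rcases eq_or_ne x 0 with rfl | hx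
  · simpa using hC
  · have h2 : ‖⟪x, x⟫_ℂ‖ ≤ C * ‖x‖ := hs.induction (P := fun w => ‖⟪x, w⟫_ℂ‖ ≤ C * ‖w‖) h
      (isClosed_le (by fun_prop) (by fun_prop)) x
    rw [inner_self_eq_norm_sq_to_K, norm_pow, RCLike.norm_ofReal, abs_norm, sq] at h2
    exact le_of_mul_le_mul_right h2 (norm_pos_iff.2 hx)

theorem IsBddDense.exists_extendsTo [CompleteSpace E] {S : E →ₗ.[ℂ] E} (hS : IsBddDense S) :
    ∃ X : E →L[ℂ] E, ExtendsTo S X := by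
  obtain ⟨hd, C, hC⟩ := hS
  let f : S.domain →L[ℂ] E := S.toFun.mkContinuous C hC
  have hdr : DenseRange S.domain.subtypeL := by
    simpa [DenseRange] using hd
  refine ⟨f.extend S.domain.subtypeL, fun x => ?_⟩
  exact ContinuousLinearMap.extend_eq f hdr isUniformEmbedding_subtype_val.isUniformInducing x

theorem ExtendsTo.pnorm_eq {S : E →ₗ.[ℂ] E} {X : E →L[ℂ] E} (hX : ExtendsTo S X)
    (hS : Dense (S.domain : Set E)) : pnorm S = ‖X‖ := by
  have hset : {C : ℝ | 0 ≤ C ∧ ∀ x : S.domain, ‖S x‖ ≤ C * ‖(x : E)‖}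
      = {C : ℝ | 0 ≤ C ∧ ∀ x : E, ‖X x‖ ≤ C * ‖x‖} := by
    ext C
    refine and_congr_right fun _ => ⟨fun h x => ?_, fun h x => ?_⟩
    · refine hS.induction (P := fun x => ‖X x‖ ≤ C * ‖x‖) (fun x hx => ?_)
        (isClosed_le (by fun_prop) (by fun_prop)) x
      rw [hX ⟨x, hx⟩]
      exact h ⟨x, hx⟩
    · rw [← hX x]
      exact h x
  rw [pnorm, hset, ContinuousLinearMap.norm_def]

theorem pnorm_nonneg (S : E →ₗ.[ℂ] E) : 0 ≤ pnorm S :=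
  Real.sInf_nonneg fun _ h => h.1

theorem pnorm_le {S : E →ₗ.[ℂ] E} {C : ℝ} (hC : 0 ≤ C) (h : ∀ x : S.domain, ‖S x‖ ≤ C * ‖(x : E)‖) :
    pnorm S ≤ C :=
  csInf_le ⟨0, fun _ h => h.1⟩ ⟨hC, h⟩

/-- For `c = 0` the domain of `[D, c a]` is larger than that of `[D, a]`, but the commutator
vanishes on it. -/
theorem ExtendsTo.smul {D : E →ₗ.[ℂ] E} {a X : E →L[ℂ] E} (hX : ExtendsTo (pcomm D a) X) (c : ℂ) :
    ExtendsTo (pcomm D (c • a)) (c • X) := by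
  rintro ⟨x, hx, hx'⟩
  change c • X x = D ⟨(c • a) x, hx'⟩ - (c • a) (D ⟨x, hx⟩)
  rcases eq_or_ne c 0 with rfl | hc
  · have h : (⟨((0 : ℂ) • a) x, hx'⟩ : D.domain) = 0 := by ext; simp
    rw [h]
    simp
  · have hax : a x ∈ D.domain := by
      have := D.domain.smul_mem c⁻¹ hx'
      change c⁻¹ • (c • a x) ∈ _ at this
      rwa [inv_smul_smul₀ hc] at this
    have h : (⟨(c • a) x, hx'⟩ : D.domain) = c • ⟨a x, hax⟩ := rfl
    have h1 : X x = D ⟨a x, hax⟩ - a (D ⟨x, hx⟩) := hX ⟨x, hx, hax⟩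
    rw [h, D.map_smul, h1, smul_sub]
    rfl

theorem pnorm_pcomm_smul [CompleteSpace E] {D : E →ₗ.[ℂ] E} {a : E →L[ℂ] E}
    (ha : IsBddDense (pcomm D a)) {c : ℂ} (hca : IsBddDense (pcomm D (c • a))) :
    pnorm (pcomm D (c • a)) = ‖c‖ * pnorm (pcomm D a) := by
  obtain ⟨X, hX⟩ := ha.exists_extendsTo
  rw [hX.pnorm_eq ha.1, (hX.smul c).pnorm_eq hca.1, norm_smul]

/-- The closure of the commutator of a symmetric operator with a self-adjoint one is
skew-adjoint. -/
theorem ExtendsTo.inner_left [CompleteSpace E] {D : E →ₗ.[ℂ] E} {a X : E →L[ℂ] E}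
    (hX : ExtendsTo (pcomm D a) X) (hd : Dense ((pcomm D a).domain : Set E))
    (hD : ∀ x y : D.domain, ⟪D x, (y : E)⟫_ℂ = ⟪(x : E), D y⟫_ℂ) (ha : IsSelfAdjoint a) (x y : E) :
    ⟪X x, y⟫_ℂ = -⟪x, X y⟫_ℂ := by
  refine hd.induction (P := fun x => ∀ y, ⟪X x, y⟫_ℂ = -⟪x, X y⟫_ℂ) (fun x hx y => ?_)
    (by simp only [Set.ofPred_forall]
        exact isClosed_iInter fun y => isClosed_eq (by fun_prop) (by fun_prop)) x y
  refine hd.induction (P := fun y => ⟪X x, y⟫_ℂ = -⟪x, X y⟫_ℂ) (fun y hy => ?_)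
    (isClosed_eq (by fun_prop) (by fun_prop)) y
  rw [show X x = D ⟨a x, hx.2⟩ - a (D ⟨x, hx.1⟩) from hX ⟨x, hx⟩,
    show X y = D ⟨a y, hy.2⟩ - a (D ⟨y, hy.1⟩) from hX ⟨y, hy⟩, inner_sub_left, inner_sub_right]
  have h1 := hD ⟨a x, hx.2⟩ ⟨y, hy.1⟩
  have h2 := hD ⟨x, hx.1⟩ ⟨a y, hy.2⟩
  have h3 : ∀ p q, ⟪a p, q⟫_ℂ = ⟪p, a q⟫_ℂ := ha.isSymmetric
  dsimp only at h1 h2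
  rw [h1, h3, h3, ← h2]
  ring

end Unbounded

/-! ### Operators with compact resolvent -/

section CompactResolvent

variable {H : Type*} [NormedAddCommGroup H] [InnerProductSpace ℂ H]

/-- The operator `R = (1 + D²)⁻¹` controls `u` for bounded `D u`: from `u = R u + D² R u` one has
`‖u‖² = ⟪u, R u⟫ + ⟪D u, D R u⟫`, and `‖D R u‖² ≤ ‖R u‖ ‖u‖`. -/
theorem norm_sq_le_of_resolvent {D : H →ₗ.[ℂ] H}
    (hD : ∀ x y : D.domain, ⟪D x, (y : H)⟫_ℂ = ⟪(x : H), D y⟫_ℂ) {R : H →L[ℂ] H}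
    (hR : ∀ x : H, ∃ (h₁ : R x ∈ D.domain) (h₂ : D ⟨R x, h₁⟩ ∈ D.domain),
      R x + D ⟨D ⟨R x, h₁⟩, h₂⟩ = x) (u : D.domain) :
    ‖(u : H)‖ ^ 2 ≤ ‖(u : H)‖ * ‖R u‖ + ‖D u‖ * √(‖R u‖ * ‖(u : H)‖) := by
  obtain ⟨h₁, h₂, h⟩ := hR u
  set y : H := D ⟨R u, h₁⟩ with hy
  have e1 : ⟪(u : H), (u : H)⟫_ℂ = ⟪(u : H), R u⟫_ℂ + ⟪D u, y⟫_ℂ := by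
    have h3 : D ⟨y, h₂⟩ = (u : H) - R u := eq_sub_of_add_eq' h
    rw [hD u ⟨y, h₂⟩, h3, inner_sub_right]
    ring
  have e2 : ⟪y, y⟫_ℂ = ⟪R u, (u : H)⟫_ℂ - ⟪R u, R u⟫_ℂ := by
    have h3 : D ⟨y, h₂⟩ = (u : H) - R u := eq_sub_of_add_eq' h
    rw [← inner_sub_right, ← h3]
    exact hD ⟨R u, h₁⟩ ⟨y, h₂⟩
  have e3 : ‖y‖ ≤ √(‖R u‖ * ‖(u : H)‖) := by
    refine Real.le_sqrt_of_sq_le ?_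
    have h3 := congrArg Complex.re e2
    rw [Complex.sub_re] at h3
    have h4 : (⟪y, y⟫_ℂ : ℂ).re = ‖y‖ ^ 2 := inner_self_eq_norm_sq (𝕜 := ℂ) y
    have h5 : (⟪R u, R u⟫_ℂ : ℂ).re = ‖R u‖ ^ 2 := inner_self_eq_norm_sq (𝕜 := ℂ) (R u)
    have h6 : (⟪R u, (u : H)⟫_ℂ : ℂ).re ≤ ‖R u‖ * ‖(u : H)‖ := re_inner_le_norm (𝕜 := ℂ) _ _
    nlinarith [sq_nonneg ‖R u‖]
  have h3 := congrArg Complex.re e1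
  rw [Complex.add_re] at h3
  have h4 : (⟪(u : H), (u : H)⟫_ℂ : ℂ).re = ‖(u : H)‖ ^ 2 := inner_self_eq_norm_sq (𝕜 := ℂ) (u : H)
  have h5 : (⟪(u : H), R u⟫_ℂ : ℂ).re ≤ ‖(u : H)‖ * ‖R u‖ := re_inner_le_norm (𝕜 := ℂ) _ _
  have h6 : (⟪D u, y⟫_ℂ : ℂ).re ≤ ‖D u‖ * ‖y‖ := re_inner_le_norm (𝕜 := ℂ) _ _
  have h7 := mul_le_mul_of_nonneg_left e3 (norm_nonneg (D u))
  linarith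

/-- The elements of the domain of `D` that are bounded in the graph norm. -/
def graphBall (D : H →ₗ.[ℂ] H) (C : ℝ) : Set H :=
  {x | ∃ h : x ∈ D.domain, ‖x‖ ≤ C ∧ ‖D ⟨x, h⟩‖ ≤ C}

/-- Compactness of `(1 + D²)⁻¹` makes the graph balls of `D` totally bounded: by
`norm_sq_le_of_resolvent`, a net for the image under `R` is a net for the graph ball. -/
theorem totallyBounded_graphBall {D : H →ₗ.[ℂ] H}
    (hD : ∀ x y : D.domain, ⟪D x, (y : H)⟫_ℂ = ⟪(x : H), D y⟫_ℂ) {R : H →L[ℂ] H}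
    (hRc : IsCompactOperator R)
    (hR : ∀ x : H, ∃ (h₁ : R x ∈ D.domain) (h₂ : D ⟨R x, h₁⟩ ∈ D.domain),
      R x + D ⟨D ⟨R x, h₁⟩, h₂⟩ = x) (C : ℝ) : TotallyBounded (graphBall D C) := by
  have himg : TotallyBounded (R '' graphBall D C) := by
    refine (IsCompactOperator.isCompact_closure_image_closedBall
      (f := (R : H →ₗ[ℂ] H)) hRc C).totallyBounded.subset ?_
    refine subset_trans ?_ subset_closure
    refine Set.image_mono ?_
    rintro x ⟨_, hx, _⟩
    simpa using hx
  rw [Metric.totallyBounded_iff]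
  intro ε hε
  obtain ⟨η, hη, hηε⟩ : ∃ η : ℝ, 0 < η ∧ 2 * C * η + 2 * C * √(η * (2 * C)) < ε ^ 2 := by
    have hcont : Continuous fun η : ℝ => 2 * C * η + 2 * C * √(η * (2 * C)) := by fun_prop
    have h0 : (fun η : ℝ => 2 * C * η + 2 * C * √(η * (2 * C))) 0 < ε ^ 2 := by
      simpa using pow_pos hε 2
    have hev := (hcont.tendsto 0).eventually (gt_mem_nhds h0)
    obtain ⟨η, h1, h2⟩ := ((hev.filter_mono (nhdsWithin_le_nhds (s := Set.Ioi 0))).and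
      self_mem_nhdsWithin).exists
    exact ⟨η, h2, h1⟩
  obtain ⟨F, hFs, hF, hnet⟩ := exists_finite_net_of_totallyBounded (graphBall D C) R himg hη
  refine ⟨F, hF, fun x hx => ?_⟩
  obtain ⟨f, hf, hxf⟩ := hnet x hx
  refine Set.mem_iUnion₂.2 ⟨f, hf, ?_⟩
  obtain ⟨hxD, hx1, hx2⟩ := hx
  obtain ⟨hfD, hf1, hf2⟩ := hFs hf
  have h1 := norm_sq_le_of_resolvent hD hR (⟨x, hxD⟩ - ⟨f, hfD⟩)
  rw [D.map_sub] at h1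
  change ‖x - f‖ ^ 2 ≤ ‖x - f‖ * ‖R (x - f)‖ + _ * √(‖R (x - f)‖ * ‖x - f‖) at h1
  have h2 : ‖x - f‖ ≤ 2 * C := (norm_sub_le _ _).trans (by linarith)
  have h3 : ‖D ⟨x, hxD⟩ - D ⟨f, hfD⟩‖ ≤ 2 * C := (norm_sub_le _ _).trans (by linarith)
  have h4 : ‖R (x - f)‖ ≤ η := by
    rw [map_sub, ← dist_eq_norm]
    exact hxf.le
  have hC : 0 ≤ 2 * C := (norm_nonneg _).trans h2
  rw [Metric.mem_ball, dist_eq_norm]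
  refine lt_of_pow_lt_pow_left₀ 2 hε.le ((h1.trans ?_).trans_lt hηε)
  gcongr

variable [CompleteSpace H]

theorem LinearPMap.inner_apply_left_of_isSelfAdjoint {D : H →ₗ.[ℂ] H} (hD : IsSelfAdjoint D)
    (x y : D.domain) : ⟪D x, (y : H)⟫_ℂ = ⟪(x : H), D y⟫_ℂ := by
  have h := LinearPMap.adjoint_isFormalAdjoint hD.dense_domain
  rw [LinearPMap.isSelfAdjoint_def.1 hD] at h
  exact h x y

/-- A closed operator whose graph balls are totally bounded is bounded below on every closed
subspace that meets its kernel trivially. -/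
theorem exists_norm_le_mul_of_ker_trivial {D : H →ₗ.[ℂ] H} (hD : D.IsClosed)
    (hcpt : TotallyBounded (graphBall D 1)) {N : Submodule ℂ H} (hN : IsClosed (N : Set H))
    (hker : ∀ u : D.domain, (u : H) ∈ N → D u = 0 → (u : H) = 0) :
    ∃ C : ℝ, 0 ≤ C ∧ ∀ u : D.domain, (u : H) ∈ N → ‖(u : H)‖ ≤ C * ‖D u‖ := by
  by_contra! hcon
  choose u huN hu using fun n : ℕ => hcon (n + 1) (by positivity)
  have hpos : ∀ n, 0 < ‖(u n : H)‖ := fun n => lt_of_le_of_lt (by positivity) (hu n)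
  set v : ℕ → D.domain := fun n => ((‖(u n : H)‖⁻¹ : ℝ) : ℂ) • u n with hv
  have hv1 : ∀ n, ‖(v n : H)‖ = 1 := by
    intro n
    have h1 : (v n : H) = ((‖(u n : H)‖⁻¹ : ℝ) : ℂ) • (u n : H) := rfl
    rw [h1, norm_smul, Complex.norm_real, norm_inv, norm_norm, inv_mul_cancel₀ (hpos n).ne']
  have hv2 : ∀ n, ‖D (v n)‖ ≤ 1 / ((n : ℝ) + 1) := by
    intro n
    rw [hv, D.map_smul, norm_smul, Complex.norm_real, norm_inv, norm_norm,
      le_div_iff₀ (by positivity), inv_mul_eq_div, div_mul_eq_mul_div, div_le_one (hpos n),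
      mul_comm]
    exact (hu n).le
  have hmem : ∀ n, (v n : H) ∈ closure (graphBall D 1) := fun n =>
    subset_closure ⟨(v n).2, (hv1 n).le, (hv2 n).trans
      (div_le_one_of_le₀ (by linarith [n.cast_nonneg (α := ℝ)]) (by positivity))⟩
  obtain ⟨x, -, φ, hφ, hx⟩ :=
    (hcpt.closure.isCompact_of_isClosed isClosed_closure).tendsto_subseq hmem
  have hDv : Filter.Tendsto (fun n => D (v (φ n))) Filter.atTop (nhds 0) :=
    (squeeze_zero_norm hv2 tendsto_one_div_add_atTop_nhds_zero_nat).comp hφ.tendsto_atTop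
  have hgraph : (x, (0 : H)) ∈ D.graph :=
    IsClosed.mem_of_tendsto hD (hx.prodMk_nhds hDv)
      (Filter.Eventually.of_forall fun n => D.mem_graph (v (φ n)))
  obtain ⟨y, hy, hy0⟩ := (D.mem_graph_iff).1 hgraph
  dsimp only at hy hy0
  have hxN : x ∈ N := hN.mem_of_tendsto hx
    (Filter.Eventually.of_forall fun n => N.smul_mem _ (huN (φ n)))
  have h0 : x = 0 := hy ▸ hker y (hy ▸ hxN) hy0
  have h1 : ‖x‖ = 1 := tendsto_nhds_unique hx.norm (by simp [hv1])
  rw [h0, norm_zero] at h1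
  exact zero_ne_one h1

/-- Symmetric operators that map the unit ball into a common totally bounded set `K` are totally
bounded in norm: if `z` is a net of `K - K` then `d = k - f` satisfies
`‖d x‖² ≈ ⟪x, d z⟫`, so that `d` is small as soon as the finitely many `d z` are. -/
theorem exists_finite_net_of_symmetric {K : Set H} (hK : TotallyBounded K)
    (s : Set (H →L[ℂ] H)) (hs : ∀ k ∈ s, ∀ x y, ⟪k x, y⟫_ℂ = ⟪x, k y⟫_ℂ)
    (hsK : ∀ k ∈ s, ∀ x, ‖x‖ ≤ 1 → k x ∈ K) {ε : ℝ} (hε : 0 < ε) :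
    ∃ F ⊆ s, F.Finite ∧ ∀ k ∈ s, ∃ f ∈ F, ‖k - f‖ ≤ ε := by
  have hcK : IsCompact (closure K) := hK.closure.isCompact_of_isClosed isClosed_closure
  have hKK : TotallyBounded ((fun p : H × H => p.1 - p.2) '' (closure K ×ˢ closure K)) :=
    ((hcK.prod hcK).image (by fun_prop)).totallyBounded
  obtain ⟨Z, hZ, hcov⟩ := Metric.totallyBounded_iff.1 hKK (ε / 2) (by positivity)
  -- the points `c z` lie in the unit ball, so that the operators of `s` send them into `K`
  obtain ⟨c, hc, hcZ⟩ : ∃ c : ℝ, 0 < c ∧ ∀ z ∈ Z, c * ‖z‖ ≤ 1 := by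
    obtain ⟨M, hM⟩ := hZ.isBounded.exists_norm_le
    refine ⟨(|M| + 1)⁻¹, by positivity, fun z hz => ?_⟩
    rw [inv_mul_le_one₀ (by positivity)]
    linarith [hM z hz, le_abs_self M]
  have := hZ.to_subtype
  obtain ⟨F, hFs, hF, hnet⟩ := exists_finite_net_pi s (fun k (z : Z) => k ((c : ℂ) • (z : H))) hcK
    (fun k hk z => subset_closure (hsK k hk _ (by
      rw [norm_smul, Complex.norm_real, Real.norm_of_nonneg hc.le]
      exact hcZ z z.2))) (by positivity : 0 < c * (ε ^ 2 / 2))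
  refine ⟨F, hFs, hF, fun k hk => ?_⟩
  obtain ⟨f, hf, hkf⟩ := hnet k hk
  refine ⟨f, hf, ContinuousLinearMap.opNorm_le_of_unit_norm hε.le fun x hx => ?_⟩
  have hmem : k x - f x ∈ (fun p : H × H => p.1 - p.2) '' (closure K ×ˢ closure K) :=
    ⟨(k x, f x), ⟨subset_closure (hsK k hk x hx.le), subset_closure (hsK f (hFs hf) x hx.le)⟩, rfl⟩
  obtain ⟨z, hz, hdz⟩ := Set.mem_iUnion₂.1 (hcov hmem)
  rw [Metric.mem_ball, dist_eq_norm] at hdz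
  have h1 : ‖k z - f z‖ ≤ ε ^ 2 / 2 := by
    have h := hkf ⟨z, hz⟩
    rw [dist_eq_norm, map_smul, map_smul, ← smul_sub, norm_smul, Complex.norm_real,
      Real.norm_of_nonneg hc.le] at h
    exact (lt_of_mul_lt_mul_left h hc.le).le
  have h2 : ⟪k x - f x, k x - f x⟫_ℂ = ⟪k x - f x, k x - f x - z⟫_ℂ + ⟪x, k z - f z⟫_ℂ := by
    rw [inner_sub_right x, ← hs k hk, ← hs f (hFs hf), ← inner_sub_left, ← inner_add_right,
      sub_add_cancel]
  have h3 := congrArg Complex.re h2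
  rw [Complex.add_re] at h3
  have h4 : (⟪k x - f x, k x - f x⟫_ℂ : ℂ).re = ‖k x - f x‖ ^ 2 := inner_self_eq_norm_sq (𝕜 := ℂ) _
  have h5 : (⟪k x - f x, k x - f x - z⟫_ℂ : ℂ).re ≤ ‖k x - f x‖ * ‖k x - f x - z‖ :=
    re_inner_le_norm (𝕜 := ℂ) _ _
  have h6 : (⟪x, k z - f z⟫_ℂ : ℂ).re ≤ ‖x‖ * ‖k z - f z‖ := re_inner_le_norm (𝕜 := ℂ) _ _
  have h7 := mul_le_mul_of_nonneg_left hdz.le (norm_nonneg (k x - f x))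
  rw [hx, one_mul] at h6
  change ‖k x - f x‖ ≤ ε
  have h8 : (‖k x - f x‖ - ε) * (‖k x - f x‖ + ε / 2) ≤ 0 := by nlinarith
  by_contra! hcon
  nlinarith [mul_pos (sub_pos.2 hcon) (by positivity : 0 < ‖k x - f x‖ + ε / 2)]

end CompactResolvent

/-! ### Commutators with the operator `D_{α,β}` -/

section Toeplitz

variable {H : Type*} [NormedAddCommGroup H] [InnerProductSpace ℂ H]

variable (Hp : Submodule ℂ H)

/-- The operator `t ⊕ a` on `K = PH ⊕ H`. -/
def diagOp (t : Hp →L[ℂ] Hp) (a : H →L[ℂ] H) : toeplitzK Hp →L[ℂ] toeplitzK Hp :=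
  ((WithLp.prodContinuousLinearEquiv 2 ℂ Hp H).symm : (Hp × H) →L[ℂ] toeplitzK Hp) ∘L
    (t.prodMap a) ∘L
    ((WithLp.prodContinuousLinearEquiv 2 ℂ Hp H) : toeplitzK Hp →L[ℂ] (Hp × H))

variable {Hp}

theorem toeplitzK_norm_le_add (x : toeplitzK Hp) : ‖x‖ ≤ ‖x.fst‖ + ‖x.snd‖ := by
  rw [WithLp.prod_norm_eq_of_L2]
  refine Real.sqrt_le_iff.2 ⟨by positivity, by nlinarith [norm_nonneg x.fst, norm_nonneg x.snd]⟩

theorem toeplitzK_norm_toLp_zero_left (v : H) :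
    ‖(WithLp.toLp 2 ((0 : Hp), v) : toeplitzK Hp)‖ = ‖v‖ := by
  simp

variable [CompleteSpace Hp]

theorem inner_orthogonalProjectionOnto_left (x : H) (u : Hp) :
    ⟪Hp.orthogonalProjectionOnto x, u⟫_ℂ = ⟪x, (u : H)⟫_ℂ :=
  Submodule.inner_orthogonalProjectionOnto_eq_of_mem_right u x

theorem inner_orthogonalProjectionOnto_right (x : H) (u : Hp) :
    ⟪u, Hp.orthogonalProjectionOnto x⟫_ℂ = ⟪(u : H), x⟫_ℂ :=
  Submodule.inner_orthogonalProjectionOnto_eq_of_mem_left u x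

variable [CompleteSpace H] {𝒜 A : StarSubalgebra ℂ (H →L[ℂ] H)} {D : H →ₗ.[ℂ] H}

theorem diagOp_isSelfAdjoint {t : Hp →L[ℂ] Hp} {a : H →L[ℂ] H} (ht : IsSelfAdjoint t)
    (ha : IsSelfAdjoint a) : IsSelfAdjoint (diagOp Hp t a) := by
  rw [ContinuousLinearMap.isSelfAdjoint_iff_isSymmetric]
  intro x y
  have h1 : ∀ p q, ⟪t p, q⟫_ℂ = ⟪p, t q⟫_ℂ := ht.isSymmetric
  have h2 : ∀ p q, ⟪a p, q⟫_ℂ = ⟪p, a q⟫_ℂ := ha.isSymmetric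
  change ⟪diagOp Hp t a x, y⟫_ℂ = ⟪x, diagOp Hp t a y⟫_ℂ
  rw [WithLp.prod_inner_apply, WithLp.prod_inner_apply]
  exact congrArg₂ _ (h1 _ _) (h2 _ _)

theorem compression_isSelfAdjoint {a : H →L[ℂ] H} (ha : IsSelfAdjoint a) :
    IsSelfAdjoint (compression Hp a) := by
  rw [ContinuousLinearMap.isSelfAdjoint_iff_isSymmetric]
  intro u v
  have h2 : ∀ p q, ⟪a p, q⟫_ℂ = ⟪p, a q⟫_ℂ := ha.isSymmetric
  change ⟪Hp.orthogonalProjectionOnto (a u), v⟫_ℂ = ⟪u, Hp.orthogonalProjectionOnto (a v)⟫_ℂ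
  rw [inner_orthogonalProjectionOnto_left, inner_orthogonalProjectionOnto_right, h2]

theorem IsToeplitzProjection.map_mem (hP : IsToeplitzProjection Hp 𝒜 D) {x : H}
    (hx : x ∈ D.domain) : Hp.starProjection x ∈ D.domain :=
  (hP.commutes_dirac ⟨x, hx⟩).1

theorem IsToeplitzProjection.apply_map (hP : IsToeplitzProjection Hp 𝒜 D) {x : H}
    (hx : x ∈ D.domain) : D ⟨Hp.starProjection x, hP.map_mem hx⟩ = Hp.starProjection (D ⟨x, hx⟩) :=
  (hP.commutes_dirac ⟨x, hx⟩).2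

theorem IsToeplitzProjection.orthogonalProjectionOnto_mem (hP : IsToeplitzProjection Hp 𝒜 D) {x : H}
    (hx : x ∈ D.domain) : Hp.orthogonalProjectionOnto x ∈ (diracP Hp D).domain :=
  hP.map_mem hx

/-- `D` maps `dom D ∩ PH` into `PH`, so that `D_p` is the restriction of `D`. -/
theorem IsToeplitzProjection.coe_diracP (hP : IsToeplitzProjection Hp 𝒜 D)
    (u : (diracP Hp D).domain) : ((diracP Hp D u : Hp) : H) = D ⟨(u : Hp), u.2⟩ := by
  have h := hP.apply_map (x := ((u : Hp) : H)) u.2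
  have h1 : Hp.starProjection ((u : Hp) : H) = (u : Hp) := by simp
  have h2 : (⟨Hp.starProjection ((u : Hp) : H), hP.map_mem u.2⟩ : D.domain) = ⟨(u : Hp), u.2⟩ :=
    Subtype.ext h1
  rw [h2] at h
  exact h.symm

theorem IsToeplitzProjection.diracP_orthogonalProjectionOnto
    (hP : IsToeplitzProjection Hp 𝒜 D) {x : H} (hx : x ∈ D.domain) :
    diracP Hp D ⟨Hp.orthogonalProjectionOnto x, hP.orthogonalProjectionOnto_mem hx⟩
      = Hp.orthogonalProjectionOnto (D ⟨x, hx⟩) := by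
  ext
  rw [hP.coe_diracP]
  exact hP.apply_map hx

theorem IsSpectralTriple.inner_dirac (hS : IsSpectralTriple 𝒜 A D) {x y : H} (hx : x ∈ D.domain)
    (hy : y ∈ D.domain) : ⟪D ⟨x, hx⟩, y⟫_ℂ = ⟪x, D ⟨y, hy⟩⟫_ℂ :=
  LinearPMap.inner_apply_left_of_isSelfAdjoint hS.selfAdjoint ⟨x, hx⟩ ⟨y, hy⟩

theorem IsToeplitzQuadruple.inner_diracP (h : IsToeplitzQuadruple Hp 𝒜 A D)
    (u v : (diracP Hp D).domain) : ⟪diracP Hp D u, (v : Hp)⟫_ℂ = ⟪(u : Hp), diracP Hp D v⟫_ℂ := by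
  rw [Submodule.coe_inner, Submodule.coe_inner, h.projection.coe_diracP, h.projection.coe_diracP]
  exact h.spectralTriple.inner_dirac u.2 v.2

theorem IsToeplitzQuadruple.dense_diracP (h : IsToeplitzQuadruple Hp 𝒜 A D) :
    Dense ((diracP Hp D).domain : Set Hp) :=
  (h.dense_p 1 A.one_mem).mono fun _ hu => hu.1

theorem IsToeplitzProjection.diracAB_toLp (hP : IsToeplitzProjection Hp 𝒜 D) (α β : ℝ) {u : Hp}
    {v : H} (hu : (u : H) ∈ D.domain) (hv : v ∈ D.domain) :
    diracAB Hp D α β ⟨WithLp.toLp 2 (u, v), hu, hv⟩ = WithLp.toLp 2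
        ((β : ℂ) • Hp.orthogonalProjectionOnto (D ⟨v, hv⟩),
          (β : ℂ) • D ⟨u, hu⟩ + ((α⁻¹ : ℝ) : ℂ) • D ⟨v, hv⟩) := by
  rw [← hP.coe_diracP ⟨u, hu⟩]
  rfl

theorem IsToeplitzQuadruple.inner_diracAB (h : IsToeplitzQuadruple Hp 𝒜 A D) (α β : ℝ)
    (x y : (diracAB Hp D α β).domain) :
    ⟪diracAB Hp D α β x, (y : toeplitzK Hp)⟫_ℂ = ⟪(x : toeplitzK Hp), diracAB Hp D α β y⟫_ℂ := by
  obtain ⟨⟨u, v⟩, hu, hv⟩ := x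
  obtain ⟨⟨u', v'⟩, hu', hv'⟩ := y
  change (u : H) ∈ D.domain at hu
  change (u' : H) ∈ D.domain at hu'
  change v ∈ D.domain at hv
  change v' ∈ D.domain at hv'
  rw [h.projection.diracAB_toLp α β hu hv, h.projection.diracAB_toLp α β hu' hv',
    WithLp.prod_inner_apply, WithLp.prod_inner_apply]
  simp only [inner_add_left, inner_add_right, inner_smul_left, inner_smul_right,
    Complex.conj_ofReal, inner_orthogonalProjectionOnto_left, inner_orthogonalProjectionOnto_right,
    h.spectralTriple.inner_dirac hv hu', h.spectralTriple.inner_dirac hu hv',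
    h.spectralTriple.inner_dirac hv hv']
  ring

/-- The upper right corner `P D a - t P D` of `[D_{α,β}, t ⊕ a]`, for `t = T(a) + k`, is bounded: it
is the difference of `P [P D, a]` and `k D_p P`. -/
theorem IsToeplitzQuadruple.norm_commutator_fst_le (h : IsToeplitzQuadruple Hp 𝒜 A D)
    {a : H →L[ℂ] H} (ha : a ∈ A) {k : Hp →L[ℂ] Hp} (hk : k ∈ compactSmooth Hp D) :
    ∃ C : ℝ, 0 ≤ C ∧ ∀ (v : H) (hv : v ∈ D.domain) (hav : a v ∈ D.domain),
      ‖Hp.orthogonalProjectionOnto (D ⟨a v, hav⟩)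
        - (compression Hp a + k) (Hp.orthogonalProjectionOnto (D ⟨v, hv⟩))‖ ≤ C * ‖v‖ := by
  obtain ⟨-, C₁, hC₁⟩ := h.comm_p a ha
  obtain ⟨-, -, C₂, hC₂⟩ := hk
  refine ⟨|C₁| + |C₂|, by positivity, fun v hv hav => ?_⟩
  have h1 := hC₁ ⟨v, hv, hav⟩
  change ‖Hp.starProjection (D ⟨a v, hav⟩) - a (Hp.starProjection (D ⟨v, hv⟩))‖ ≤ C₁ * ‖v‖ at h1
  have h2 := hC₂ ⟨_, h.projection.orthogonalProjectionOnto_mem hv⟩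
  rw [h.projection.diracP_orthogonalProjectionOnto hv] at h2
  dsimp only at h2
  have h3 : Hp.orthogonalProjectionOnto (D ⟨a v, hav⟩)
        - (compression Hp a + k) (Hp.orthogonalProjectionOnto (D ⟨v, hv⟩))
      = Hp.orthogonalProjectionOnto
          (Hp.starProjection (D ⟨a v, hav⟩) - a (Hp.starProjection (D ⟨v, hv⟩)))
        - k (Hp.orthogonalProjectionOnto (D ⟨v, hv⟩)) := by
    have h4 : (compression Hp a + k) (Hp.orthogonalProjectionOnto (D ⟨v, hv⟩))
        = Hp.orthogonalProjectionOnto (a (Hp.starProjection (D ⟨v, hv⟩)))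
          + k (Hp.orthogonalProjectionOnto (D ⟨v, hv⟩)) := rfl
    have h5 : Hp.orthogonalProjectionOnto (Hp.starProjection (D ⟨a v, hav⟩))
        = Hp.orthogonalProjectionOnto (D ⟨a v, hav⟩) := by
      ext
      exact Submodule.starProjection_eq_self_iff.2 (Hp.starProjection_apply_mem _)
    rw [h4, map_sub, h5]
    abel
  have h6 : ∀ x : H, ‖Hp.orthogonalProjectionOnto x‖ ≤ ‖x‖ := fun x =>
    Hp.norm_orthogonalProjectionOnto_apply_le x
  rw [h3]
  calc _ ≤ C₁ * ‖v‖ + C₂ * ‖Hp.orthogonalProjectionOnto v‖ :=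
        (norm_sub_le _ _).trans (add_le_add ((h6 _).trans h1) h2)
    _ ≤ |C₁| * ‖v‖ + |C₂| * ‖v‖ := by
        gcongr
        · exact le_abs_self _
        · exact le_abs_self _
        · exact h6 v
    _ = _ := by ring

/-- The lower left corner of `[D_{α,β}, t ⊕ a]` is, up to the factor `β`, minus the adjoint of the
upper right corner, so that it has the same bound. -/
theorem IsToeplitzQuadruple.norm_commutator_snd_le (h : IsToeplitzQuadruple Hp 𝒜 A D)
    {a : H →L[ℂ] H} (ha : a ∈ A) (hsa : IsSelfAdjoint a) {t : Hp →L[ℂ] Hp} (ht : IsSelfAdjoint t)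
    {C : ℝ} (hC : 0 ≤ C) (hbd : ∀ (v : H) (hv : v ∈ D.domain) (hav : a v ∈ D.domain),
      ‖Hp.orthogonalProjectionOnto (D ⟨a v, hav⟩)
        - t (Hp.orthogonalProjectionOnto (D ⟨v, hv⟩))‖ ≤ C * ‖v‖)
    (u : Hp) (hu : (u : H) ∈ D.domain) (htu : (t u : H) ∈ D.domain) :
    ‖D ⟨t u, htu⟩ - a (D ⟨u, hu⟩)‖ ≤ C * ‖u‖ := by
  refine norm_le_of_forall_inner_le (h.spectralTriple.comm a ha).1 (by positivity) ?_
  rintro w ⟨hw, haw⟩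
  change a w ∈ D.domain at haw
  have h1 : ∀ p q, ⟪t p, q⟫_ℂ = ⟪p, t q⟫_ℂ := ht.isSymmetric
  have h2 : ∀ p q, ⟪a p, q⟫_ℂ = ⟪p, a q⟫_ℂ := hsa.isSymmetric
  have h3 : ⟪D ⟨t u, htu⟩ - a (D ⟨u, hu⟩), w⟫_ℂ = -⟪u, Hp.orthogonalProjectionOnto (D ⟨a w, haw⟩)
        - t (Hp.orthogonalProjectionOnto (D ⟨w, hw⟩))⟫_ℂ := by
    rw [inner_sub_left, inner_sub_right, h2, h.spectralTriple.inner_dirac htu hw,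
      h.spectralTriple.inner_dirac hu haw, ← h1, inner_orthogonalProjectionOnto_right,
      inner_orthogonalProjectionOnto_right]
    ring
  rw [h3, norm_neg]
  calc _ ≤ ‖u‖ * (C * ‖w‖) := (norm_inner_le_norm _ _).trans (by gcongr; exact hbd w hw haw)
    _ = _ := by ring

/-- The value of the commutator `[D_{α,β}, t ⊕ a]`. -/
theorem IsToeplitzProjection.pcomm_diracAB_apply (hP : IsToeplitzProjection Hp 𝒜 D) (α β : ℝ)
    (t : Hp →L[ℂ] Hp) (a : H →L[ℂ] H) {u : Hp} {v : H} (hu : (u : H) ∈ D.domain)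
    (hv : v ∈ D.domain) (htu : (t u : H) ∈ D.domain) (hav : a v ∈ D.domain) :
    pcomm (diracAB Hp D α β) (diagOp Hp t a) ⟨WithLp.toLp 2 (u, v), ⟨hu, hv⟩, ⟨htu, hav⟩⟩
      = WithLp.toLp 2 ((β : ℂ) • (Hp.orthogonalProjectionOnto (D ⟨a v, hav⟩)
            - t (Hp.orthogonalProjectionOnto (D ⟨v, hv⟩))),
          (β : ℂ) • (D ⟨t u, htu⟩ - a (D ⟨u, hu⟩))
            + ((α⁻¹ : ℝ) : ℂ) • (D ⟨a v, hav⟩ - a (D ⟨v, hv⟩))) := by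
  have h1 : pcomm (diracAB Hp D α β) (diagOp Hp t a) ⟨WithLp.toLp 2 (u, v), ⟨hu, hv⟩, ⟨htu, hav⟩⟩
      = diracAB Hp D α β ⟨WithLp.toLp 2 (t u, a v), htu, hav⟩
        - diagOp Hp t a (diracAB Hp D α β ⟨WithLp.toLp 2 (u, v), hu, hv⟩) := rfl
  have h2 : ∀ p q, diagOp Hp t a (WithLp.toLp 2 (p, q)) = WithLp.toLp 2 (t p, a q) := fun _ _ => rfl
  rw [h1, hP.diracAB_toLp α β htu hav, hP.diracAB_toLp α β hu hv, h2, ← WithLp.toLp_sub,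
    Prod.mk_sub_mk]
  congr 2
  · rw [map_smul, smul_sub]
  · rw [map_add, map_smul, map_smul, smul_sub, smul_sub]
    abel

theorem IsToeplitzQuadruple.dense_pcomm_diracAB (h : IsToeplitzQuadruple Hp 𝒜 A D) (α β : ℝ)
    {a : H →L[ℂ] H} (ha : a ∈ A) {k : Hp →L[ℂ] Hp} (hk : k ∈ compactSmooth Hp D) :
    Dense ((pcomm (diracAB Hp D α β) (diagOp Hp (compression Hp a + k) a)).domain :
      Set (toeplitzK Hp)) := by
  have h1 := (h.dense_p a ha).prod (h.spectralTriple.comm a ha).1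
  have h2 := h1.preimage (WithLp.homeomorphProd 2 Hp H).isOpenMap
  refine h2.mono ?_
  rintro ⟨u, v⟩ ⟨hu, hv⟩
  obtain ⟨-, ⟨C, hC⟩, -⟩ := hk
  refine ⟨⟨hu.1, hv.1⟩, ⟨?_, hv.2⟩⟩
  exact (diracP Hp D).domain.add_mem (h.projection.orthogonalProjectionOnto_mem hu.2) (hC u).1

theorem IsToeplitzQuadruple.isBddDense (h : IsToeplitzQuadruple Hp 𝒜 A D) (α β : ℝ)
    {a : H →L[ℂ] H} (ha : a ∈ spaceA A) {k : Hp →L[ℂ] Hp} (hk : k ∈ compactSmoothSA Hp D) :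
    IsBddDense (pcomm (diracAB Hp D α β) (diagOp Hp (compression Hp a + k) a)) := by
  refine ⟨h.dense_pcomm_diracAB α β ha.1 hk.1, ?_⟩
  obtain ⟨C, hC, hbd⟩ := h.norm_commutator_fst_le ha.1 hk.1
  obtain ⟨-, B, hB⟩ := h.spectralTriple.comm a ha.1
  refine ⟨2 * (|β| * C) + |α⁻¹| * |B|, ?_⟩
  rintro ⟨⟨u, v⟩, ⟨hu, hv⟩, ⟨htu, hav⟩⟩
  change (u : H) ∈ D.domain at hu
  change v ∈ D.domain at hv
  change a v ∈ D.domain at hav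
  change (((compression Hp a + k) u : Hp) : H) ∈ D.domain at htu
  rw [h.projection.pcomm_diracAB_apply α β _ a hu hv htu hav]
  have h1 := hbd v hv hav
  have h2 := h.norm_commutator_snd_le ha.1 ha.2 ((compression_isSelfAdjoint ha.2).add hk.2)
    hC hbd u hu htu
  have h3 : ‖D ⟨a v, hav⟩ - a (D ⟨v, hv⟩)‖ ≤ |B| * ‖v‖ :=
    (hB ⟨v, hv, hav⟩).trans (by gcongr; exact le_abs_self B)
  have h4 : ‖u‖ ≤ ‖(WithLp.toLp 2 (u, v) : toeplitzK Hp)‖ :=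
    WithLp.norm_fst_le Hp (WithLp.toLp 2 (u, v))
  have h5 : ‖v‖ ≤ ‖(WithLp.toLp 2 (u, v) : toeplitzK Hp)‖ :=
    WithLp.norm_snd_le Hp (WithLp.toLp 2 (u, v))
  refine (toeplitzK_norm_le_add _).trans ?_
  change ‖(β : ℂ) • _‖ + ‖(β : ℂ) • _ + ((α⁻¹ : ℝ) : ℂ) • _‖ ≤ _
  set n := ‖(WithLp.toLp 2 (u, v) : toeplitzK Hp)‖
  calc _ ≤ |β| * (C * ‖v‖) + (|β| * (C * ‖u‖) + |α⁻¹| * (|B| * ‖v‖)) := by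
        refine add_le_add ?_ ((norm_add_le _ _).trans (add_le_add ?_ ?_)) <;>
        · rw [norm_smul, Complex.norm_real, Real.norm_eq_abs]
          gcongr
    _ ≤ |β| * (C * n) + (|β| * (C * n) + |α⁻¹| * (|B| * n)) := by gcongr
    _ = _ := by ring

/-! ### The matrix entries of the closed commutator -/

section MatrixEntries

variable {α β : ℝ} {a : H →L[ℂ] H} {k : Hp →L[ℂ] Hp} {X : toeplitzK Hp →L[ℂ] toeplitzK Hp}
  {δ : H →L[ℂ] H}

/-- The value of the closed commutator at `0 ⊕ v`, for `v` in the domain of `[D, a]`. -/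
theorem IsToeplitzQuadruple.extension_apply_right (h : IsToeplitzQuadruple Hp 𝒜 A D)
    {t : Hp →L[ℂ] Hp} (hX : ExtendsTo (pcomm (diracAB Hp D α β) (diagOp Hp t a)) X)
    {v : H} (hv : v ∈ D.domain) (hav : a v ∈ D.domain) :
    X (WithLp.toLp 2 (0, v)) = WithLp.toLp 2 ((β : ℂ) • (Hp.orthogonalProjectionOnto (D ⟨a v, hav⟩)
            - t (Hp.orthogonalProjectionOnto (D ⟨v, hv⟩))),
          ((α⁻¹ : ℝ) : ℂ) • (D ⟨a v, hav⟩ - a (D ⟨v, hv⟩))) := by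
  have h0 : ((0 : Hp) : H) ∈ D.domain := D.domain.zero_mem
  have ht0 : (t 0 : H) ∈ D.domain := by rw [map_zero]; exact h0
  have h1 := hX ⟨WithLp.toLp 2 (0, v), ⟨h0, hv⟩, ⟨ht0, hav⟩⟩
  rw [h.projection.pcomm_diracAB_apply α β t a h0 hv ht0 hav] at h1
  refine h1.trans ?_
  have e1 : (⟨(t 0 : H), ht0⟩ : D.domain) = 0 := by ext; simp
  have e2 : (⟨((0 : Hp) : H), h0⟩ : D.domain) = 0 := rfl
  rw [e1, e2, D.map_zero, map_zero, sub_zero, smul_zero, zero_add]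

/-- The lower right corner of the closed commutator is `α⁻¹` times the closure `δ` of `[D, a]`. -/
theorem IsToeplitzQuadruple.extension_right_snd (h : IsToeplitzQuadruple Hp 𝒜 A D)
    {t : Hp →L[ℂ] Hp} (hX : ExtendsTo (pcomm (diracAB Hp D α β) (diagOp Hp t a)) X)
    (ha : a ∈ A) (hδ : ExtendsTo (pcomm D a) δ) (v : H) :
    (X (WithLp.toLp 2 (0, v))).snd = ((α⁻¹ : ℝ) : ℂ) • δ v := by
  refine (h.spectralTriple.comm a ha).1.induction
    (P := fun v => (X (WithLp.toLp 2 (0, v))).snd = ((α⁻¹ : ℝ) : ℂ) • δ v) ?_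
    (isClosed_eq (by fun_prop) (by fun_prop)) v
  rintro v ⟨hv, hav⟩
  rw [h.extension_apply_right hX hv hav, hδ ⟨v, hv, hav⟩]
  rfl

/-- The upper left corner of the closed commutator vanishes. -/
theorem IsToeplitzQuadruple.extension_left_fst (h : IsToeplitzQuadruple Hp 𝒜 A D)
    (hk : k ∈ compactSmooth Hp D)
    (hX : ExtendsTo (pcomm (diracAB Hp D α β) (diagOp Hp (compression Hp a + k) a)) X)
    (ha : a ∈ A) (u : Hp) : (X (WithLp.toLp 2 (u, 0))).fst = 0 := by
  refine (h.dense_p a ha).induction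
    (P := fun u => (X (WithLp.toLp 2 (u, 0))).fst = 0) ?_
    (isClosed_eq (by fun_prop) (by fun_prop)) u
  rintro u ⟨hu, hau⟩
  obtain ⟨-, ⟨C, hC⟩, -⟩ := hk
  have htu : ((compression Hp a + k) u : H) ∈ D.domain :=
    (diracP Hp D).domain.add_mem (h.projection.orthogonalProjectionOnto_mem hau) (hC u).1
  have h0 : (0 : H) ∈ D.domain := D.domain.zero_mem
  have ha0 : a 0 ∈ D.domain := by rw [map_zero]; exact h0
  have h1 := hX ⟨WithLp.toLp 2 (u, 0), ⟨hu, h0⟩, ⟨htu, ha0⟩⟩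
  rw [h.projection.pcomm_diracAB_apply α β _ a hu h0 htu ha0] at h1
  have h2 := congrArg WithLp.fst h1
  refine h2.trans ?_
  have e1 : (⟨a 0, ha0⟩ : D.domain) = 0 := by ext; simp
  have e2 : (⟨0, h0⟩ : D.domain) = 0 := rfl
  change (β : ℂ) • _ = _
  rw [e1, e2, D.map_zero, map_zero, map_zero, sub_zero, smul_zero]

/-- The upper right corner of the closed commutator is, on `PH`, the closure of
`β (P [D, a] - k D_p)`. In the weak form stated here `D_p` stands to the left of `k`, where the
product is everywhere defined. -/
theorem IsToeplitzQuadruple.inner_extension_right_fst (h : IsToeplitzQuadruple Hp 𝒜 A D)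
    (hk : IsSelfAdjoint k)
    (hX : ExtendsTo (pcomm (diracAB Hp D α β) (diagOp Hp (compression Hp a + k) a)) X)
    (ha : a ∈ A) (hδ : ExtendsTo (pcomm D a) δ) (v u : Hp) (hku : k u ∈ (diracP Hp D).domain) :
    ⟪(X (WithLp.toLp 2 (0, (v : H)))).fst, u⟫_ℂ
      = (β : ℂ) * (⟪δ v, (u : H)⟫_ℂ - ⟪v, diracP Hp D ⟨k u, hku⟩⟫_ℂ) := by
  refine (h.dense_p a ha).induction
    (P := fun v : Hp => ⟪(X (WithLp.toLp 2 (0, (v : H)))).fst, u⟫_ℂ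
      = (β : ℂ) * (⟪δ v, (u : H)⟫_ℂ - ⟪v, diracP Hp D ⟨k u, hku⟩⟫_ℂ)) ?_
    (isClosed_eq (by fun_prop) (by fun_prop)) v
  rintro v ⟨hv, hav⟩
  have h1 : ∀ p q, ⟪k p, q⟫_ℂ = ⟪p, k q⟫_ℂ := hk.isSymmetric
  have h2 : Hp.orthogonalProjectionOnto (D ⟨v, hv⟩) = diracP Hp D ⟨v, hv⟩ := rfl
  have h3 : (compression Hp a + k) (diracP Hp D ⟨v, hv⟩)
      = Hp.orthogonalProjectionOnto (a (D ⟨v, hv⟩)) + k (diracP Hp D ⟨v, hv⟩) := by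
    rw [← h.projection.coe_diracP ⟨v, hv⟩]
    rfl
  rw [h.extension_apply_right hX hv hav, hδ ⟨v, hv, hav⟩]
  change ⟪(β : ℂ) • (_ - _), u⟫_ℂ = (β : ℂ) * (⟪D ⟨a v, hav⟩ - a (D ⟨v, hv⟩), (u : H)⟫_ℂ - _)
  rw [h2, h3, inner_smul_left, Complex.conj_ofReal, inner_sub_left, inner_add_left, inner_sub_left,
    inner_orthogonalProjectionOnto_left, inner_orthogonalProjectionOnto_left, h1,
    h.inner_diracP ⟨v, hv⟩ ⟨k u, hku⟩]
  ring

/-- The upper right corner of the closed commutator is, on `(I - P) H`, the closure of `β P D a`. In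
the weak form stated here only the domain of `D_p`, which does not depend on `a`, matters. -/
theorem IsToeplitzQuadruple.inner_extension_orthogonal_fst (h : IsToeplitzQuadruple Hp 𝒜 A D)
    {t : Hp →L[ℂ] Hp} (hX : ExtendsTo (pcomm (diracAB Hp D α β) (diagOp Hp t a)) X)
    (ha : a ∈ A) (hsa : IsSelfAdjoint a) (v : Hpᗮ) {u : Hp}
    (hu : (u : H) ∈ D.domain) :
    ⟪(X (WithLp.toLp 2 (0, (v : H)))).fst, u⟫_ℂ
      = (β : ℂ) * ⟪(v : H), a (D ⟨u, hu⟩)⟫_ℂ := by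
  refine (h.dense_q a ha).induction
    (P := fun v : Hpᗮ => ⟪(X (WithLp.toLp 2 (0, (v : H)))).fst, u⟫_ℂ
      = (β : ℂ) * ⟪(v : H), a (D ⟨u, hu⟩)⟫_ℂ) ?_
    (isClosed_eq (by fun_prop) (by fun_prop)) v
  rintro v ⟨hv, hav⟩
  change a v ∈ D.domain at hav
  have h2 : ∀ p q, ⟪a p, q⟫_ℂ = ⟪p, a q⟫_ℂ := hsa.isSymmetric
  have h1 : Hp.orthogonalProjectionOnto (D ⟨v, hv⟩) = 0 := by
    rw [← h.projection.diracP_orthogonalProjectionOnto hv]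
    have : (⟨Hp.orthogonalProjectionOnto (v : H), h.projection.orthogonalProjectionOnto_mem hv⟩ :
        (diracP Hp D).domain) = 0 :=
      Subtype.ext (Submodule.orthogonalProjectionOnto_eq_zero_iff.2 v.2)
    rw [this, LinearPMap.map_zero]
  rw [h.extension_apply_right hX hv hav]
  change ⟪(β : ℂ) • (_ - _), u⟫_ℂ = _
  rw [h1, map_zero, sub_zero, inner_smul_left, Complex.conj_ofReal,
    inner_orthogonalProjectionOnto_left, h.spectralTriple.inner_dirac hav hu, h2]

end MatrixEntries

/-- The closure of `[D_{α,β}, T(a) + k ⊕ a]` is additive in `(a, k)`. For the diagonal entry this is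
the hypothesis on `D`. The upper right corner is additive on `PH` because it is there
`β (P [D, a] - k D_p)`, and on `(I - P) H` because its adjoint is there the operator `a D_p`, up to
a factor; the lower left corner follows by skew-adjointness. -/
theorem IsToeplitzQuadruple.extension_add (h : IsToeplitzQuadruple Hp 𝒜 A D)
    (hadd : CommutatorClosureAdditive A D) {α β : ℝ} {a b : H →L[ℂ] H} (ha : a ∈ spaceA A)
    (hb : b ∈ spaceA A) {k l : Hp →L[ℂ] Hp} (hk : k ∈ compactSmoothSA Hp D)
    (hl : l ∈ compactSmoothSA Hp D) {X Y Z : toeplitzK Hp →L[ℂ] toeplitzK Hp}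
    (hX : ExtendsTo (pcomm (diracAB Hp D α β) (diagOp Hp (compression Hp a + k) a)) X)
    (hY : ExtendsTo (pcomm (diracAB Hp D α β) (diagOp Hp (compression Hp b + l) b)) Y)
    (hZ : ExtendsTo (pcomm (diracAB Hp D α β)
      (diagOp Hp (compression Hp (a + b) + (k + l)) (a + b))) Z) : Z = X + Y := by
  have hab := (spaceA A).add_mem ha hb
  have hkl := (compactSmoothSA Hp D).add_mem hk hl
  obtain ⟨δa, hδa⟩ := (h.spectralTriple.comm a ha.1).exists_extendsTo
  obtain ⟨δb, hδb⟩ := (h.spectralTriple.comm b hb.1).exists_extendsTo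
  obtain ⟨δ, hδ⟩ := (h.spectralTriple.comm (a + b) hab.1).exists_extendsTo
  have hδadd : δ = δa + δb := hadd a ha.1 b hb.1 ha.2 hb.2 δa δb δ hδa hδb hδ
  have hskew : ∀ {c : H →L[ℂ] H} {m : Hp →L[ℂ] Hp} {W : toeplitzK Hp →L[ℂ] toeplitzK Hp},
      c ∈ spaceA A → m ∈ compactSmoothSA Hp D →
      ExtendsTo (pcomm (diracAB Hp D α β) (diagOp Hp (compression Hp c + m) c)) W →
      ∀ x y, ⟪W x, y⟫_ℂ = -⟪x, W y⟫_ℂ := fun hc hm hW =>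
    hW.inner_left (h.isBddDense α β hc hm).1 (h.inner_diracAB α β)
      (diagOp_isSelfAdjoint ((compression_isSelfAdjoint hc.2).add hm.2) hc.2)
  -- the difference `Z - X - Y` vanishes on `0 ⊕ H`, the summands `PH` and `(I - P) H` of `H` being
  -- treated separately; by skew-adjointness it then vanishes on `PH ⊕ 0` as well
  have hsnd : ∀ v : H, ((Z - X - Y) (WithLp.toLp 2 (0, v))).snd = 0 := by
    intro v
    change (Z _).snd - (X _).snd - (Y _).snd = 0
    rw [h.extension_right_snd hX ha.1 hδa, h.extension_right_snd hY hb.1 hδb,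
      h.extension_right_snd hZ hab.1 hδ, hδadd, add_apply, smul_add]
    abel
  have hfst₁ : ∀ v : Hp, ((Z - X - Y) (WithLp.toLp 2 (0, (v : H)))).fst = 0 := by
    intro v
    refine ext_inner_right ℂ fun u => ?_
    obtain ⟨-, ⟨C, hC⟩, -⟩ := hk.1
    obtain ⟨-, ⟨C', hC'⟩, -⟩ := hl.1
    have hku := (hC u).1
    have hlu := (hC' u).1
    change ⟪(Z _).fst - (X _).fst - (Y _).fst, u⟫_ℂ = _
    rw [inner_sub_left, inner_sub_left, h.inner_extension_right_fst hk.2 hX ha.1 hδa v u hku,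
      h.inner_extension_right_fst hl.2 hY hb.1 hδb v u hlu,
      h.inner_extension_right_fst hkl.2 hZ hab.1 hδ v u ((diracP Hp D).domain.add_mem hku hlu)]
    have h1 : diracP Hp D ⟨(k + l) u, (diracP Hp D).domain.add_mem hku hlu⟩
        = diracP Hp D ⟨k u, hku⟩ + diracP Hp D ⟨l u, hlu⟩ :=
      (diracP Hp D).map_add ⟨k u, hku⟩ ⟨l u, hlu⟩
    rw [h1, hδadd, add_apply, inner_add_left, inner_add_right, inner_zero_left]
    ring
  have hfst₂ : ∀ v : Hpᗮ, ((Z - X - Y) (WithLp.toLp 2 (0, (v : H)))).fst = 0 := by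
    intro v
    refine h.dense_diracP.eq_zero_of_inner_left ℂ fun u hu => ?_
    change ⟪(Z _).fst - (X _).fst - (Y _).fst, u⟫_ℂ = _
    rw [inner_sub_left, inner_sub_left, h.inner_extension_orthogonal_fst hX ha.1 ha.2 v hu,
      h.inner_extension_orthogonal_fst hY hb.1 hb.2 v hu,
      h.inner_extension_orthogonal_fst hZ hab.1 hab.2 v hu, add_apply, inner_add_right]
    ring
  have hright : ∀ v : H, (Z - X - Y) (WithLp.toLp 2 (0, v)) = 0 := by
    intro v
    have hsplit : (WithLp.toLp 2 (0, v) : toeplitzK Hp)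
        = WithLp.toLp 2 (0, ((Hp.orthogonalProjectionOnto v : Hp) : H))
          + WithLp.toLp 2 (0, ((Hpᗮ.orthogonalProjectionOnto v : Hpᗮ) : H)) := by
      rw [← WithLp.toLp_add, Prod.mk_add_mk, add_zero]
      congr 2
      exact (Hp.starProjection_add_starProjection_orthogonal v).symm
    have hfst : ((Z - X - Y) (WithLp.toLp 2 (0, v))).fst = 0 := by
      rw [hsplit, map_add]
      exact (congrArg₂ (· + ·) (hfst₁ _) (hfst₂ _)).trans (add_zero 0)
    exact WithLp.ofLp_injective 2 (Prod.ext hfst (hsnd v))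
  have hleft : ∀ u : Hp, (Z - X - Y) (WithLp.toLp 2 (u, 0)) = 0 := by
    intro u
    have hfst : ((Z - X - Y) (WithLp.toLp 2 (u, 0))).fst = 0 := by
      change (Z _).fst - (X _).fst - (Y _).fst = 0
      rw [h.extension_left_fst hk.1 hX ha.1, h.extension_left_fst hl.1 hY hb.1,
        h.extension_left_fst hkl.1 hZ hab.1, sub_zero, sub_zero]
    refine ext_inner_right ℂ fun y => ?_
    have h1 : ⟪(Z - X - Y) (WithLp.toLp 2 (u, 0)), y⟫_ℂ
        = ⟪(Z - X - Y) (WithLp.toLp 2 (u, 0)), WithLp.toLp 2 (0, y.snd)⟫_ℂ := by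
      rw [WithLp.prod_inner_apply, WithLp.prod_inner_apply]
      change ⟪((Z - X - Y) (WithLp.toLp 2 (u, 0))).fst, _⟫_ℂ + _
        = ⟪((Z - X - Y) (WithLp.toLp 2 (u, 0))).fst, _⟫_ℂ + _
      rw [hfst, inner_zero_left, inner_zero_left]
      rfl
    have h2 : ∀ x y, ⟪(Z - X - Y) x, y⟫_ℂ = -⟪x, (Z - X - Y) y⟫_ℂ := by
      intro x y
      change ⟪Z x - X x - Y x, y⟫_ℂ = -⟪x, Z y - X y - Y y⟫_ℂ
      simp only [inner_sub_left, inner_sub_right, hskew ha hk hX x y, hskew hb hl hY x y,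
        hskew hab hkl hZ x y]
      ring
    rw [h1, h2, hright, inner_zero_right, inner_zero_left, neg_zero]
  have hzero : Z - X - Y = 0 := by
    ext1 x
    have hsplit : x = WithLp.toLp 2 (x.fst, 0) + WithLp.toLp 2 (0, x.snd) := by
      rw [← WithLp.toLp_add, Prod.mk_add_mk, add_zero, zero_add]
      rfl
    rw [hsplit, map_add, hleft, hright, add_zero]
    rfl
  rw [sub_sub] at hzero
  exact sub_eq_zero.1 hzero

/-! ### Lower bounds for the seminorm -/

/-- Commutators bounded by `c` force `‖[D, a]‖ ≤ α c`. -/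
theorem IsToeplitzQuadruple.pnorm_pcomm_le (h : IsToeplitzQuadruple Hp 𝒜 A D) {α β : ℝ} (hα : 0 < α)
    {a : H →L[ℂ] H} (ha : a ∈ spaceA A) {k : Hp →L[ℂ] Hp} (hk : k ∈ compactSmoothSA Hp D) :
    pnorm (pcomm D a)
      ≤ α * pnorm (pcomm (diracAB Hp D α β) (diagOp Hp (compression Hp a + k) a)) := by
  have hbd := h.isBddDense α β ha hk
  obtain ⟨X, hX⟩ := hbd.exists_extendsTo
  rw [hX.pnorm_eq hbd.1]
  refine pnorm_le (by positivity) ?_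
  rintro ⟨v, hv, hav⟩
  have h1 := (WithLp.norm_snd_le Hp _).trans (X.le_opNorm (WithLp.toLp 2 ((0 : Hp), v)))
  rw [h.extension_apply_right hX hv hav, toeplitzK_norm_toLp_zero_left] at h1
  change ‖((α⁻¹ : ℝ) : ℂ) • (D ⟨a v, hav⟩ - a (D ⟨v, hv⟩))‖ ≤ _ at h1
  rw [norm_smul, Complex.norm_real, Real.norm_of_nonneg (inv_pos.2 hα).le,
    inv_mul_le_iff₀ hα, ← mul_assoc] at h1
  exact h1

/-- Commutators bounded by `c` force `‖D_p k‖ ≤ (α + β⁻¹) c`: on `PH` the upper right corner of the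
commutator is `β (P [D, a] - k D_p)`, and `D_p k` is the adjoint of `k D_p`. -/
theorem IsToeplitzQuadruple.norm_diracP_apply_le (h : IsToeplitzQuadruple Hp 𝒜 A D) {α β : ℝ}
    (hα : 0 < α) (hβ : 0 < β) {a : H →L[ℂ] H} (ha : a ∈ spaceA A) {k : Hp →L[ℂ] Hp}
    (hk : k ∈ compactSmoothSA Hp D) (u : Hp) (hku : k u ∈ (diracP Hp D).domain) :
    ‖diracP Hp D ⟨k u, hku⟩‖ ≤ (α + β⁻¹)
      * pnorm (pcomm (diracAB Hp D α β) (diagOp Hp (compression Hp a + k) a)) * ‖u‖ := by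
  have hbd := h.isBddDense α β ha hk
  obtain ⟨X, hX⟩ := hbd.exists_extendsTo
  obtain ⟨δ, hδ⟩ := (h.spectralTriple.comm a ha.1).exists_extendsTo
  have hδle := h.pnorm_pcomm_le (β := β) hα ha hk
  rw [hδ.pnorm_eq (h.spectralTriple.comm a ha.1).1] at hδle
  rw [hX.pnorm_eq hbd.1] at hδle ⊢
  refine norm_le_of_forall_inner_le dense_univ (by positivity) fun v _ => ?_
  have h1 := h.inner_extension_right_fst hk.2 hX ha.1 hδ v u hku
  have h2 : ⟪v, diracP Hp D ⟨k u, hku⟩⟫_ℂ = ⟪δ v, (u : H)⟫_ℂ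
      - ((β⁻¹ : ℝ) : ℂ) * ⟪(X (WithLp.toLp 2 (0, (v : H)))).fst, u⟫_ℂ := by
    rw [h1, Complex.ofReal_inv, inv_mul_cancel_left₀ (by exact_mod_cast hβ.ne')]
    ring
  have h3 : ‖(X (WithLp.toLp 2 (0, (v : H)))).fst‖ ≤ ‖X‖ * ‖v‖ := by
    have := (WithLp.norm_fst_le Hp _).trans (X.le_opNorm (WithLp.toLp 2 ((0 : Hp), (v : H))))
    rw [toeplitzK_norm_toLp_zero_left] at this
    exact this
  rw [norm_inner_symm, h2]
  calc _ ≤ ‖δ v‖ * ‖(u : H)‖ + β⁻¹ * (‖(X (WithLp.toLp 2 (0, (v : H)))).fst‖ * ‖u‖) := by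
        refine (norm_sub_le _ _).trans (add_le_add (norm_inner_le_norm _ _) ?_)
        rw [norm_mul, Complex.norm_real, Real.norm_of_nonneg (inv_pos.2 hβ).le]
        gcongr
        exact norm_inner_le_norm _ _
    _ ≤ (α * ‖X‖ * ‖v‖) * ‖u‖ + β⁻¹ * ((‖X‖ * ‖v‖) * ‖u‖) := by
        gcongr
        · exact (δ.le_opNorm _).trans (by gcongr; rfl)
        · rfl
    _ = _ := by ring

end Toeplitz

/-! ### Order-unit spaces of self-adjoint operators -/

section OperatorSpaces

variable {E : Type*} [NormedAddCommGroup E] [InnerProductSpace ℂ E]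

theorem re_inner_real_smul_apply (r : ℝ) (a : E →L[ℂ] E) (x : E) :
    (⟪(r • a) x, x⟫_ℂ).re = r * (⟪a x, x⟫_ℂ).re := by
  rw [← Complex.coe_smul r a, smul_apply, inner_smul_left, Complex.conj_ofReal,
    Complex.re_ofReal_mul]

theorem re_inner_real_smul_one (r : ℝ) (x : E) :
    (⟪(r • (1 : E →L[ℂ] E)) x, x⟫_ℂ).re = r * ‖x‖ ^ 2 := by
  rw [re_inner_real_smul_apply]
  congr 1
  exact inner_self_eq_norm_sq (𝕜 := ℂ) x

theorem abs_re_inner_le (a : E →L[ℂ] E) (x : E) : |(⟪a x, x⟫_ℂ).re| ≤ ‖a‖ * ‖x‖ ^ 2 :=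
  calc _ ≤ ‖a x‖ * ‖x‖ := (Complex.abs_re_le_norm _).trans (norm_inner_le_norm _ _)
    _ ≤ ‖a‖ * ‖x‖ * ‖x‖ := by gcongr; exact a.le_opNorm x
    _ = _ := by ring

variable [CompleteSpace E]

theorem ContinuousLinearMap.le_iff_forall_re_inner {a b : E →L[ℂ] E} (ha : IsSelfAdjoint a)
    (hb : IsSelfAdjoint b) : a ≤ b ↔ ∀ x, (⟪a x, x⟫_ℂ).re ≤ (⟪b x, x⟫_ℂ).re := by
  rw [ContinuousLinearMap.le_def, ContinuousLinearMap.isPositive_def',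
    and_iff_right (hb.sub ha)]
  refine forall_congr' fun x => ?_
  rw [ContinuousLinearMap.reApplyInnerSelf_apply, sub_apply, inner_sub_left, map_sub, sub_nonneg]
  rfl

theorem isSelfAdjoint_real_smul_one (r : ℝ) : IsSelfAdjoint (r • (1 : E →L[ℂ] E)) :=
  (selfAdjoint.submodule ℝ (E →L[ℂ] E)).smul_mem r (IsSelfAdjoint.one _)

/-- The order interval `[-r, r]` in terms of the quadratic form. -/
theorem mem_orderInterval_iff {a : E →L[ℂ] E} (ha : IsSelfAdjoint a) (r : ℝ) :
    (-(r • (1 : E →L[ℂ] E)) ≤ a ∧ a ≤ r • (1 : E →L[ℂ] E))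
      ↔ ∀ x, |(⟪a x, x⟫_ℂ).re| ≤ r * ‖x‖ ^ 2 := by
  have hr := isSelfAdjoint_real_smul_one (E := E) r
  rw [ContinuousLinearMap.le_iff_forall_re_inner hr.neg ha,
    ContinuousLinearMap.le_iff_forall_re_inner ha hr, ← forall_and]
  refine forall_congr' fun x => ?_
  rw [re_inner_real_smul_one, neg_apply, inner_neg_left, Complex.neg_re, re_inner_real_smul_one,
    abs_le]

variable {V : Submodule ℝ (E →L[ℂ] E)} {e : V}

/-- A real space of self-adjoint operators that contains `1` is an order-unit space. -/
theorem isOrderUnitSpace_of_isSelfAdjoint (hV : ∀ a ∈ V, IsSelfAdjoint a)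
    (he : (e : E →L[ℂ] E) = 1) : IsOrderUnitSpace e where
  add_le_add_right a b c h := by
    rw [← Subtype.coe_le_coe] at h ⊢
    rw [Submodule.coe_add, Submodule.coe_add]
    gcongr
  smul_le_smul r a b hr h := by
    rw [← Subtype.coe_le_coe] at h ⊢
    rw [ContinuousLinearMap.le_iff_forall_re_inner (hV _ a.2) (hV _ b.2)] at h
    rw [ContinuousLinearMap.le_iff_forall_re_inner (hV _ (r • a).2) (hV _ (r • b).2)]
    intro x
    rw [Submodule.coe_smul, Submodule.coe_smul, re_inner_real_smul_apply, re_inner_real_smul_apply]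
    exact mul_le_mul_of_nonneg_left (h x) hr
  order_unit a := by
    refine ⟨‖(a : E →L[ℂ] E)‖, ?_⟩
    rw [← Subtype.coe_le_coe, Submodule.coe_smul, he]
    exact ((mem_orderInterval_iff (hV _ a.2) _).2 (abs_re_inner_le _)).2
  archimedean a h := by
    rw [← Subtype.coe_le_coe, Submodule.coe_zero,
      ContinuousLinearMap.le_iff_forall_re_inner (hV _ a.2) (IsSelfAdjoint.zero _)]
    intro x
    rw [zero_apply, inner_zero_left, Complex.zero_re]
    have h1 : ∀ r : ℝ, 0 < r → (⟪(a : E →L[ℂ] E) x, x⟫_ℂ).re ≤ r * ‖x‖ ^ 2 := by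
      intro r hr
      have h2 := h r hr
      rw [← Subtype.coe_le_coe, Submodule.coe_smul, he,
        ContinuousLinearMap.le_iff_forall_re_inner (hV _ a.2) (isSelfAdjoint_real_smul_one r)] at h2
      rw [← re_inner_real_smul_one]
      exact h2 x
    refine le_of_forall_pos_le_add fun ε hε => ?_
    have h3 := h1 (ε / (‖x‖ ^ 2 + 1)) (by positivity)
    have h4 : ε / (‖x‖ ^ 2 + 1) * ‖x‖ ^ 2 ≤ ε := by
      rw [div_mul_eq_mul_div, div_le_iff₀ (by positivity)]
      nlinarith
    linarith

/-- The vector state `a ↦ ⟪a x, x⟫` of a unit vector `x`. -/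
noncomputable def vectorState (hV : ∀ a ∈ V, IsSelfAdjoint a) (he : (e : E →L[ℂ] E) = 1) (x : E)
    (hx : ‖x‖ = 1) : OrderUnitState e :=
  ⟨{ toFun := fun a => (⟪(a : E →L[ℂ] E) x, x⟫_ℂ).re
     map_add' := fun a b => by
       rw [Submodule.coe_add, add_apply, inner_add_left, Complex.add_re]
     map_smul' := fun r a => by
       rw [Submodule.coe_smul, re_inner_real_smul_apply]
       rfl }, by
    constructor
    · change (⟪(e : E →L[ℂ] E) x, x⟫_ℂ).re = 1
      have := re_inner_real_smul_one 1 x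
      rwa [one_smul, ← he, hx, one_pow, mul_one] at this
    · intro a
      refine le_csInf ⟨‖(a : E →L[ℂ] E)‖, ?_⟩ ?_
      · have := (mem_orderInterval_iff (hV _ a.2) _).2 (abs_re_inner_le (a : E →L[ℂ] E))
        rw [Set.mem_ofPred_eq, ← Subtype.coe_le_coe, ← Subtype.coe_le_coe, Submodule.coe_neg,
          Submodule.coe_smul, he]
        exact this
      · intro r hr
        rw [Set.mem_ofPred_eq, ← Subtype.coe_le_coe, ← Subtype.coe_le_coe, Submodule.coe_neg,
          Submodule.coe_smul, he] at hr
        have := (mem_orderInterval_iff (hV _ a.2) _).1 hr x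
        rwa [hx, one_pow, mul_one] at this⟩

/-- Bounds on all states give bounds on the quadratic form, since vector states are states. -/
theorem abs_re_inner_le_of_forall_state (hV : ∀ a ∈ V, IsSelfAdjoint a)
    (he : (e : E →L[ℂ] E) = 1) {a : V} {c : ℝ} (h : ∀ μ : OrderUnitState e, |μ.1 a| ≤ c) (x : E) :
    |(⟪(a : E →L[ℂ] E) x, x⟫_ℂ).re| ≤ c * ‖x‖ ^ 2 := by
  rcases eq_or_ne x 0 with rfl | hx
  · simp
  have hx' : ‖x‖ ≠ 0 := norm_ne_zero_iff.2 hx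
  have h1 := h (vectorState hV he (((‖x‖⁻¹ : ℝ) : ℂ) • x) (by
    rw [norm_smul, Complex.norm_real, norm_inv, norm_norm, inv_mul_cancel₀ hx']))
  change |(⟪(a : E →L[ℂ] E) (((‖x‖⁻¹ : ℝ) : ℂ) • x), ((‖x‖⁻¹ : ℝ) : ℂ) • x⟫_ℂ).re| ≤ c at h1
  rw [map_smul, inner_smul_left, inner_smul_right, Complex.conj_ofReal, Complex.re_ofReal_mul,
    Complex.re_ofReal_mul, ← mul_assoc, abs_mul, abs_mul_self, ← mul_inv, inv_mul_le_iff₀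
      (by positivity), ← sq, mul_comm] at h1
  exact h1

end OperatorSpaces

/-! ### Elements of the Toeplitz space -/

section Toeplitz

variable {H : Type*} [NormedAddCommGroup H] [InnerProductSpace ℂ H]

variable {Hp : Submodule ℂ H} [CompleteSpace Hp]

theorem compression_one : compression Hp 1 = 1 := by
  ext u
  exact Submodule.starProjection_eq_self_iff.2 u.2

theorem inner_compression (a : H →L[ℂ] H) (u v : Hp) :
    ⟪compression Hp a u, v⟫_ℂ = ⟪a u, (v : H)⟫_ℂ :=
  inner_orthogonalProjectionOnto_left (a u) v

theorem compression_real_smul (r : ℝ) (a : H →L[ℂ] H) :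
    compression Hp (r • a) = r • compression Hp a :=
  ((compression Hp).restrictScalars ℝ).map_smul r a

/-- The quadratic form of `T(a) + k - (T(α f) + g) - α r` on `PH`, sorted into a part that comes
from `H` and a part that comes from the compact operators. -/
theorem re_inner_compression_sub {α : ℝ} (hα : α ≠ 0) (a f : H →L[ℂ] H) (k g : Hp →L[ℂ] Hp)
    (r : ℝ) (x : Hp) :
    (⟪(compression Hp a + k - (compression Hp (α • f) + g)
        - (α * r) • (1 : Hp →L[ℂ] Hp)) x, x⟫_ℂ).re
      = α * (⟪(α⁻¹ • a - f - r • (1 : H →L[ℂ] H)) (x : H), (x : H)⟫_ℂ).re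
        + (⟪(k - g) x, x⟫_ℂ).re := by
  have h1 : (⟪((α * r) • (1 : Hp →L[ℂ] Hp)) x, x⟫_ℂ).re = α * r * ‖x‖ ^ 2 := by
    have : ((α * r) • (1 : Hp →L[ℂ] Hp)) x = ((α * r : ℝ) : ℂ) • x := rfl
    rw [this, inner_smul_left, Complex.conj_ofReal, Complex.re_ofReal_mul]
    congr 1
    exact inner_self_eq_norm_sq (𝕜 := ℂ) x
  rw [sub_apply, sub_apply, add_apply, add_apply, inner_sub_left, inner_sub_left, inner_add_left,
    inner_add_left, inner_compression, inner_compression, Complex.sub_re, Complex.sub_re,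
    Complex.add_re, Complex.add_re, re_inner_real_smul_apply α f, h1]
  rw [sub_apply, sub_apply, sub_apply, inner_sub_left, inner_sub_left, inner_sub_left,
    Complex.sub_re, Complex.sub_re, Complex.sub_re, re_inner_real_smul_apply α⁻¹ a,
    re_inner_real_smul_one, Submodule.coe_norm]
  have h2 : α * α⁻¹ = 1 := mul_inv_cancel₀ hα
  linear_combination (-(⟪a x, (x : H)⟫_ℂ).re) * h2

variable [CompleteSpace H] {𝒜 A : StarSubalgebra ℂ (H →L[ℂ] H)}
  {D : H →ₗ.[ℂ] H}

/-- The scalars in `A_𝒞` can be absorbed into `A_𝒜`, because `T(1) = 1`. -/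
theorem mem_spaceT_iff {t : Hp →L[ℂ] Hp} :
    t ∈ spaceT Hp A D ↔ ∃ a ∈ spaceA A, ∃ k ∈ compactSmoothSA Hp D, t = compression Hp a + k := by
  constructor
  · intro ht
    obtain ⟨_, ⟨a, ha, rfl⟩, c, hc, rfl⟩ := Submodule.mem_sup.1 ht
    obtain ⟨k, hk, _, hl, rfl⟩ := Submodule.mem_sup.1 hc
    obtain ⟨r, rfl⟩ := Submodule.mem_span_singleton.1 hl
    refine ⟨a + r • 1, (spaceA A).add_mem ha ((spaceA A).smul_mem r (unitA A).2), k, hk, ?_⟩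
    have h1 : compression Hp (a + r • 1) = compression Hp a + r • 1 := by
      rw [map_add, compression_real_smul, compression_one]
    rw [h1]
    change compression Hp a + _ = _
    abel
  · rintro ⟨a, ha, k, hk, rfl⟩
    exact Submodule.add_mem_sup ⟨a, ha, rfl⟩ (Submodule.mem_sup_left hk)

theorem isSelfAdjoint_of_mem_spaceT {t : Hp →L[ℂ] Hp} (ht : t ∈ spaceT Hp A D) :
    IsSelfAdjoint t := by
  obtain ⟨a, ha, k, hk, rfl⟩ := mem_spaceT_iff.1 ht
  exact (compression_isSelfAdjoint ha.2).add hk.2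

/-- `ρ` sends `T(a) + k` to `a`, as `φ` is injective and `κ` kills the compact operator `k`. -/
theorem IsToeplitzQuadruple.toeplitzRho_eq (h : IsToeplitzQuadruple Hp 𝒜 A D) {a : H →L[ℂ] H}
    (ha : a ∈ A) {k : Hp →L[ℂ] Hp} (hk : IsCompactOperator k) :
    toeplitzRho Hp 𝒜 (compression Hp a + k) = a := by
  have ha' : a ∈ 𝒜 := by
    rw [← h.spectralTriple.closure_eq]
    exact A.le_topologicalClosure ha
  have h1 : ∃ b ∈ (𝒜 : Set (H →L[ℂ] H)), toeplitzPhi Hp b = calkinMk Hp (compression Hp a + k) := by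
    refine ⟨a, ha', ?_⟩
    have h2 : calkinMk Hp k = 0 := (Submodule.Quotient.mk_eq_zero _).2 hk
    rw [map_add, h2, add_zero]
    rfl
  refine h.projection.faithful (Function.invFunOn_mem h1) ha' ((Function.invFunOn_eq h1).trans ?_)
  have h2 : calkinMk Hp k = 0 := (Submodule.Quotient.mk_eq_zero _).2 hk
  rw [map_add, h2, add_zero]
  rfl

theorem IsToeplitzQuadruple.toeplitzPi_eq (h : IsToeplitzQuadruple Hp 𝒜 A D) {a : H →L[ℂ] H}
    (ha : a ∈ A) {k : Hp →L[ℂ] Hp} (hk : IsCompactOperator k) :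
    toeplitzPi Hp 𝒜 (compression Hp a + k) = diagOp Hp (compression Hp a + k) a := by
  rw [← congrArg (diagOp Hp (compression Hp a + k)) (h.toeplitzRho_eq ha hk)]
  rfl

variable {α β : ℝ}

/-! ### The seminorm on the Toeplitz space -/

theorem IsToeplitzQuadruple.lipAB_eq (h : IsToeplitzQuadruple Hp 𝒜 A D) {a : H →L[ℂ] H}
    (ha : a ∈ spaceA A) {k : Hp →L[ℂ] Hp} (hk : k ∈ compactSmoothSA Hp D) {t : spaceT Hp A D}
    (ht : (t : Hp →L[ℂ] Hp) = compression Hp a + k) :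
    lipAB Hp 𝒜 A D α β t
      = pnorm (pcomm (diracAB Hp D α β) (diagOp Hp (compression Hp a + k) a)) := by
  rw [lipAB, ht, h.toeplitzPi_eq ha.1 hk.1.1]

theorem IsToeplitzQuadruple.isBddDense_toeplitzPi (h : IsToeplitzQuadruple Hp 𝒜 A D)
    (t : spaceT Hp A D) :
    IsBddDense (pcomm (diracAB Hp D α β) (toeplitzPi Hp 𝒜 (t : Hp →L[ℂ] Hp))) := by
  obtain ⟨a, ha, k, hk, ht⟩ := mem_spaceT_iff.1 t.2
  rw [ht, h.toeplitzPi_eq ha.1 hk.1.1]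
  exact h.isBddDense α β ha hk

theorem IsToeplitzQuadruple.lipAB_add_le (h : IsToeplitzQuadruple Hp 𝒜 A D)
    (hadd : CommutatorClosureAdditive A D) (s t : spaceT Hp A D) :
    lipAB Hp 𝒜 A D α β (s + t) ≤ lipAB Hp 𝒜 A D α β s + lipAB Hp 𝒜 A D α β t := by
  obtain ⟨a, ha, k, hk, hs⟩ := mem_spaceT_iff.1 s.2
  obtain ⟨b, hb, l, hl, ht⟩ := mem_spaceT_iff.1 t.2
  have hab := (spaceA A).add_mem ha hb
  have hkl := (compactSmoothSA Hp D).add_mem hk hl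
  have hst : ((s + t : spaceT Hp A D) : Hp →L[ℂ] Hp) = compression Hp (a + b) + (k + l) := by
    rw [Submodule.coe_add, hs, ht, map_add]
    abel
  have h1 := h.isBddDense α β ha hk
  have h2 := h.isBddDense α β hb hl
  have h3 := h.isBddDense α β hab hkl
  obtain ⟨X, hX⟩ := h1.exists_extendsTo
  obtain ⟨Y, hY⟩ := h2.exists_extendsTo
  obtain ⟨Z, hZ⟩ := h3.exists_extendsTo
  rw [h.lipAB_eq ha hk hs, h.lipAB_eq hb hl ht, h.lipAB_eq hab hkl hst, hX.pnorm_eq h1.1,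
    hY.pnorm_eq h2.1, hZ.pnorm_eq h3.1, h.extension_add hadd ha hb hk hl hX hY hZ]
  exact norm_add_le X Y

theorem IsToeplitzQuadruple.lipAB_smul (h : IsToeplitzQuadruple Hp 𝒜 A D) (r : ℝ)
    (t : spaceT Hp A D) : lipAB Hp 𝒜 A D α β (r • t) = |r| * lipAB Hp 𝒜 A D α β t := by
  obtain ⟨a, ha, k, hk, ht⟩ := mem_spaceT_iff.1 t.2
  have hra := (spaceA A).smul_mem r ha
  have hrk := (compactSmoothSA Hp D).smul_mem r hk
  have hrt : ((r • t : spaceT Hp A D) : Hp →L[ℂ] Hp) = compression Hp (r • a) + r • k := by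
    rw [Submodule.coe_smul, ht, smul_add, compression_real_smul]
  have hdiag : diagOp Hp (compression Hp (r • a) + r • k) (r • a)
      = (r : ℂ) • diagOp Hp (compression Hp a + k) a := by
    have h1 : compression Hp (r • a) + r • k = (r : ℂ) • (compression Hp a + k) := by
      rw [compression_real_smul, smul_add]
      rfl
    rw [h1, ← Complex.coe_smul r a]
    rfl
  have hbdd := h.isBddDense α β hra hrk
  rw [h.lipAB_eq ha hk ht, h.lipAB_eq hra hrk hrt]
  rw [hdiag] at hbdd ⊢
  rw [pnorm_pcomm_smul (h.isBddDense α β ha hk) hbdd, Complex.norm_real, Real.norm_eq_abs]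

theorem IsToeplitzQuadruple.lipAB_unitT (h : IsToeplitzQuadruple Hp 𝒜 A D) :
    lipAB Hp 𝒜 A D α β (unitT Hp A D) = 0 := by
  have h1 : ((unitT Hp A D : spaceT Hp A D) : Hp →L[ℂ] Hp) = compression Hp 1 + 0 := by
    rw [compression_one, add_zero]
    rfl
  rw [h.lipAB_eq (a := 1) (unitA A).2 (compactSmoothSA Hp D).zero_mem h1, compression_one, add_zero]
  refine le_antisymm (pnorm_le le_rfl ?_) (pnorm_nonneg _)
  rintro ⟨x, hx, hx'⟩
  have h2 : pcomm (diracAB Hp D α β) (diagOp Hp 1 1) ⟨x, hx, hx'⟩ = 0 :=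
    sub_self (diracAB Hp D α β ⟨x, hx⟩)
  rw [h2, norm_zero, zero_mul]

/-- If the commutator vanishes then `[D, a] = 0`, so that `a` is a scalar, and `D_p k = 0`, so that
`k = 0` because `D_p` is injective. -/
theorem IsToeplitzQuadruple.lipAB_eq_zero_iff (h : IsToeplitzQuadruple Hp 𝒜 A D)
    (hLip : IsLipNorm (unitA A) (lipA A D)) (hα : 0 < α) (hβ : 0 < β) (t : spaceT Hp A D) :
    lipAB Hp 𝒜 A D α β t = 0 ↔ ∃ r : ℝ, t = r • unitT Hp A D := by
  constructor
  · intro h0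
    obtain ⟨a, ha, k, hk, ht⟩ := mem_spaceT_iff.1 t.2
    rw [h.lipAB_eq ha hk ht] at h0
    have hδ := h.pnorm_pcomm_le (β := β) hα ha hk
    rw [h0, mul_zero] at hδ
    obtain ⟨r, hr⟩ := (hLip.eq_zero_iff ⟨a, ha⟩).1 (le_antisymm hδ (pnorm_nonneg _))
    have hk0 : k = 0 := by
      ext1 u
      obtain ⟨-, ⟨C, hC⟩, -⟩ := hk.1
      have h1 := h.norm_diracP_apply_le (β := β) hα hβ ha hk u (hC u).1
      rw [h0, mul_zero, zero_mul, norm_le_zero_iff] at h1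
      exact h.ker_trivial _ h1
    refine ⟨r, Subtype.ext ?_⟩
    have ha' : a = r • 1 := congrArg Subtype.val hr
    rw [ht, hk0, add_zero, ha', compression_real_smul, compression_one]
    rfl
  · rintro ⟨r, rfl⟩
    rw [h.lipAB_smul, h.lipAB_unitT, mul_zero]

/-! ### Total boundedness -/

/-- The self-adjoint `k` in `A_c` with `‖D_p k‖ ≤ C` are totally bounded in norm: they map the
unit ball of `PH` into a graph ball of `D`. -/
theorem IsToeplitzQuadruple.exists_finite_net_compactSmooth (h : IsToeplitzQuadruple Hp 𝒜 A D)
    {C : ℝ} (hC : 0 ≤ C) {ε : ℝ} (hε : 0 < ε) :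
    ∃ F ⊆ (compactSmoothSA Hp D : Set (Hp →L[ℂ] Hp)), F.Finite ∧ ∀ k ∈ compactSmoothSA Hp D,
      (∀ (u : Hp) (hku : k u ∈ (diracP Hp D).domain), ‖diracP Hp D ⟨k u, hku⟩‖ ≤ C * ‖u‖) →
      ∃ f ∈ F, ‖k - f‖ ≤ ε := by
  obtain ⟨R, hRc, hR⟩ := h.spectralTriple.compact_resolvent
  have htb := totallyBounded_graphBall
    (LinearPMap.inner_apply_left_of_isSelfAdjoint h.spectralTriple.selfAdjoint) hRc hR
  obtain ⟨B, hB, hbelow⟩ := exists_norm_le_mul_of_ker_trivial h.spectralTriple.selfAdjoint.isClosed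
    (htb 1) (N := Hp) (IsComplete.isClosed (completeSpace_coe_iff_isComplete.1 ‹_›)) (by
      rintro ⟨u, hu⟩ huN hDu
      refine congrArg Subtype.val (h.ker_trivial ⟨⟨u, huN⟩, hu⟩ (Subtype.ext ?_))
      rw [h.projection.coe_diracP]
      exact hDu)
  set K : Set Hp := Subtype.val ⁻¹' graphBall D ((B + 1) * C)
  have hK : TotallyBounded K :=
    totallyBounded_preimage isUniformEmbedding_subtype_val.isUniformInducing (htb _)
  set s : Set (Hp →L[ℂ] Hp) := {k | k ∈ compactSmoothSA Hp D ∧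
    ∀ (u : Hp) (hku : k u ∈ (diracP Hp D).domain), ‖diracP Hp D ⟨k u, hku⟩‖ ≤ C * ‖u‖}
  have hsK : ∀ k ∈ s, ∀ x, ‖x‖ ≤ 1 → k x ∈ K := by
    intro k hk x hx
    obtain ⟨-, ⟨M, hM⟩, -⟩ := hk.1.1
    have hkx := (hM x).1
    have h1 : ‖D ⟨(k x : Hp), hkx⟩‖ ≤ C := by
      rw [← h.projection.coe_diracP ⟨k x, hkx⟩]
      exact (hk.2 x hkx).trans (mul_le_of_le_one_right hC hx)
    have h2 : ‖((k x : Hp) : H)‖ ≤ B * C :=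
      (hbelow ⟨(k x : Hp), hkx⟩ (k x).2).trans (mul_le_mul_of_nonneg_left h1 hB)
    exact ⟨hkx, by nlinarith, by nlinarith [mul_nonneg hB hC]⟩
  obtain ⟨F, hFs, hF, hnet⟩ := exists_finite_net_of_symmetric hK s
    (fun k hk => hk.1.2.isSymmetric) hsK hε
  exact ⟨F, fun k hk => (hFs hk).1, hF, fun k hk hkC => hnet k ⟨hk, hkC⟩⟩

/-- The unit ball of `L_{α,β}` is totally bounded modulo scalars. If `L_{α,β}(T(a) + k) ≤ 1` then
`L_𝒜(a) ≤ α` and `‖D_p k‖ ≤ α + β⁻¹`, and there are finite nets for both of these conditions. -/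
theorem IsToeplitzQuadruple.totallyBoundedModUnit (h : IsToeplitzQuadruple Hp 𝒜 A D)
    (hLip : IsLipNorm (unitA A) (lipA A D)) (hα : 0 < α) (hβ : 0 < β) :
    TotallyBoundedModUnit (unitT Hp A D) (lipAB Hp 𝒜 A D α β) := by
  intro ε hε
  obtain ⟨F, hF, hFnet⟩ := hLip.exists_finite_net (by positivity : 0 < α⁻¹ * (ε / 2))
  obtain ⟨G, hGs, hG, hGnet⟩ := h.exists_finite_net_compactSmooth
    (by positivity : 0 ≤ α + β⁻¹) (by positivity : 0 < ε / 2)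
  have hG' := hG.to_subtype
  have hF' := hF.to_subtype
  -- `F` is a net for the unit ball of `L_𝒜`, so that `α F` is one for the ball of radius `α`
  refine ⟨Set.range fun p : F × G => ⟨compression Hp (α • (p.1 : spaceA A) : spaceA A) + p.2,
    mem_spaceT_iff.2 ⟨_, (α • (p.1 : spaceA A)).2, _, hGs p.2.2, rfl⟩⟩, Set.finite_range _, ?_⟩
  intro t ht
  obtain ⟨a, ha, k, hk, hta⟩ := mem_spaceT_iff.1 t.2
  rw [h.lipAB_eq ha hk hta] at ht
  have hδ : lipA A D (α⁻¹ • ⟨a, ha⟩) ≤ 1 := by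
    rw [hLip.smul, abs_of_pos (inv_pos.2 hα), inv_mul_le_one₀ hα]
    exact (h.pnorm_pcomm_le (β := β) hα ha hk).trans (mul_le_of_le_one_right hα.le ht)
  obtain ⟨f, hf, r, hfr⟩ := hFnet _ hδ
  obtain ⟨g, hg, hkg⟩ := hGnet k hk fun u hku =>
    (h.norm_diracP_apply_le (β := β) hα hβ ha hk u hku).trans
      (mul_le_mul_of_nonneg_right (mul_le_of_le_one_right (by positivity) ht) (norm_nonneg u))
  refine ⟨_, ⟨(⟨f, hf⟩, ⟨g, hg⟩), rfl⟩, α * r, ?_⟩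
  have hb : ∀ x : H, |(⟪(α⁻¹ • a - f - r • (1 : H →L[ℂ] H)) x, x⟫_ℂ).re|
      ≤ α⁻¹ * (ε / 2) * ‖x‖ ^ 2 :=
    abs_re_inner_le_of_forall_state (V := spaceA A) (fun _ hx => hx.2) rfl hfr
  set c : spaceT Hp A D := t - _ - (α * r) • unitT Hp A D with hcdef
  have hquad : ∀ x : Hp, |(⟪(c : Hp →L[ℂ] Hp) x, x⟫_ℂ).re| ≤ ε * ‖x‖ ^ 2 := by
    intro x
    have h2 : (⟪(c : Hp →L[ℂ] Hp) x, x⟫_ℂ).re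
        = α * (⟪(α⁻¹ • a - f - r • (1 : H →L[ℂ] H)) (x : H), (x : H)⟫_ℂ).re
          + (⟪(k - g) x, x⟫_ℂ).re := by
      rw [← re_inner_compression_sub hα.ne', ← hta]
      rfl
    have h3 := abs_re_inner_le (k - g) x
    have h4 : ‖k - g‖ * ‖x‖ ^ 2 ≤ ε / 2 * ‖x‖ ^ 2 :=
      mul_le_mul_of_nonneg_right hkg (sq_nonneg _)
    rw [h2]
    calc _ ≤ α * |(⟪(α⁻¹ • a - f - r • (1 : H →L[ℂ] H)) (x : H), (x : H)⟫_ℂ).re|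
          + |(⟪(k - g) x, x⟫_ℂ).re| := by
          refine (abs_add_le _ _).trans_eq ?_
          rw [abs_mul, abs_of_pos hα]
      _ ≤ α * (α⁻¹ * (ε / 2) * ‖x‖ ^ 2) + ε / 2 * ‖x‖ ^ 2 :=
          add_le_add (mul_le_mul_of_nonneg_left (hb x) hα.le) (h3.trans h4)
      _ = ε * ‖x‖ ^ 2 := by
          rw [mul_assoc α⁻¹, mul_inv_cancel_left₀ hα.ne']
          ring
  exact (mem_orderInterval_iff (isSelfAdjoint_of_mem_spaceT c.2) ε).2 hquad

end Toeplitz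

theorem mainTheorem4 {H : Type*} [NormedAddCommGroup H] [InnerProductSpace ℂ H] [CompleteSpace H]
    (𝒜 A : StarSubalgebra ℂ (H →L[ℂ] H)) (D : H →ₗ.[ℂ] H)
    (Hp : Submodule ℂ H) [CompleteSpace Hp]
    (hquad : IsToeplitzQuadruple Hp 𝒜 A D)
    (hadd : CommutatorClosureAdditive A D)
    (hLip : IsLipNorm (unitA A) (lipA A D))
    (α β : ℝ) (hα : 0 < α) (hβ : 0 < β) (hαβ : α * β ≤ 1) :
    (∀ t : spaceT Hp A D,
      IsBddDense (pcomm (diracAB Hp D α β) (toeplitzPi Hp 𝒜 (t : Hp →L[ℂ] Hp)))) ∧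
    IsLipNorm (unitT Hp A D) (lipAB Hp 𝒜 A D α β) ∧
    IsCompactQuantumMetricSpace (unitT Hp A D) (lipAB Hp 𝒜 A D α β) := by
  have hlip : IsLipNorm (unitT Hp A D) (lipAB Hp 𝒜 A D α β) :=
    { add_le := hquad.lipAB_add_le hadd
      smul := hquad.lipAB_smul
      eq_zero_iff := hquad.lipAB_eq_zero_iff hLip hα hβ
      topology_eq := lipTopology_eq_weakStarTopology (fun _ => pnorm_nonneg _) hquad.lipAB_smul
        (fun t => (hquad.lipAB_eq_zero_iff hLip hα hβ t).1)
        (hquad.totallyBoundedModUnit hLip hα hβ) }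
  exact ⟨hquad.isBddDense_toeplitzPi, hlip,
    isOrderUnitSpace_of_isSelfAdjoint (fun _ => isSelfAdjoint_of_mem_spaceT) rfl, hlip⟩
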